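/- **Theorem.** Consider a strongly convex body of revolution rolling without slipping on a horizontal plane under gravity of strength $\mathrm g$. Let $m>0$ be its mass, $\mathbb I=\mathrm{diag}(\mathbb I_1,\mathbb I_1,\mathbb I_3)$ with $\mathbb I_1,\mathbb I_3>0$ its inertia tensor, and let $$s(\boldsymbol\gamma)=(\varrho(\gamma_3)\gamma_1,\ \varrho(\gamma_3)\gamma_2,\ \zeta(\gamma_3)),\qquad \boldsymbol\gamma\in S^2,$$ be the inverse Gauss map (inward normal $\boldsymbol\gamma$, origin at the centre of mass) of its smooth strongly convex surface, where $\varrho,\zeta$ are smooth near $[-1,1]$. The configuration space is $Q=\{(g,\boldsymbol a)\in SO(3)\times\mathbb R^3: a_3=-\langle\boldsymbol\gamma,s(\boldsymbol\gamma)\rangle\}$, with $\boldsymbol\gamma$ the third row of $g$; the constraint distribution $D$ is $\dot{\boldsymbol a}=-g(\boldsymbol\Omega\times s)$, with $\boldsymbol\Omega$ the body angular velocity; the Lagrangian is $\frac12\langle\mathbb I\boldsymbol\Omega,\boldsymbol\Omega\rangle+\frac12 m\langle\dot{\boldsymbol a},\dot{\boldsymbol a}\rangle-m\mathrm g\,a_3$.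 Let $\mathcal M=\kappa^\flat(D)\subset T^*Q$ ($\kappa$ the kinetic energy metric) with coordinates $(g,\boldsymbol a,\mathbf M)$, $\mathbf M=\mathbb I\boldsymbol\Omega+m\,s\times(\boldsymbol\Omega\times s)$; let $\Theta_{\mathcal M}$ be the restriction of the Liouville form to $\mathcal M$, $\Omega_{\mathcal M}=-d\Theta_{\mathcal M}$, $\mathcal H_{\mathcal M}$ the Hamiltonian on $\mathcal M$, and $\mathcal C$ the distribution of the tangent vectors of $\mathcal M$ that project into $D$. Let $G=S^1\times E(2)$ act on $Q$ by $(g,\boldsymbol a)\mapsto(h_\varphi g h_\theta^{-1},\,h_\varphi\boldsymbol a+(x,y,0))$, where $h_\theta$, $h_\varphi$ are rotations about $e_3$, and on $\mathcal M$ by the lift, with $\mathbf M\mapsto h_\theta\mathbf M$. Let $\mathfrak g_S\to Q$ be the bundle with fibres $\{\xi\in\mathfrak g:\xi_Q(q)\in D_q\cap T_q(G\cdot q)\}$. A *horizontal gauge momentum* is a function $J\in C^\infty(\mathcal M)$ with $J=\Theta_{\mathcal M}(\chi_{\mathcal M})$ for some smooth section $\chi$ of $\mathfrak g_S$ and with $X_{\rm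 nh}(J)=0$, where $X_{\rm nh}$ is the nonholonomic vector field. Put $L=\varrho\,\tau_1-\zeta$, $\ \sigma=m\langle s,\boldsymbol\gamma\rangle=m(\varrho(1-\tau_1^2)+\zeta\tau_1)$, $\ P=\mathbb I_1\mathbb I_3+m\langle\mathbb I s,s\rangle$, and, as functions of $\tau_1=\gamma_3\in[-1,1]$ with $'=d/d\tau_1$, $$[\mathcal{QP}]=\frac mP\begin{pmatrix}\mathbb I_3(-\varrho^2-\varrho'\zeta)-\varrho^3\sigma&-\varrho\,\mathbb I_1(\varrho\tau_1-\varrho'(1-\tau_1^2))-\varrho^2\zeta\sigma\\ \mathbb I_3(\varrho L+L'\zeta)+\varrho^2L\sigma&\varrho\,\mathbb I_1(L\tau_1-L'(1-\tau_1^2))+\varrho\zeta L\sigma\end{pmatrix}.$$ Consider the linear system $$\begin{pmatrix}f'\\g'\end{pmatrix}=\begin{pmatrix}\tau_1&-1\\1&0\end{pmatrix}[\mathcal{QP}]^T\begin{pmatrix}f\\g\end{pmatrix}\quad\text{on }[-1,1].\tag{$*$}$$ Then the following hold. 1. $X_{\rm nh}$ is well defined: at each point of $\mathcal M$ there is exactly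 one $v\in\mathcal C$ with $\mathbf i_v\Omega_{\mathcal M}|_{\mathcal C}=d\mathcal H_{\mathcal M}|_{\mathcal C}$. 2. With $\tau_3=\gamma_1M_1+\gamma_2M_2$ and $\tau_4=M_3$, the functions $(\mathcal Q,\mathcal P)^T=[\mathcal{QP}](\tau_3,\tau_4)^T$ satisfy, on $\mathcal C$, $$\langle\mathcal J,\mathcal K_{\mathcal W}\rangle-m\varrho\langle\boldsymbol\gamma,s\rangle\langle\boldsymbol\Omega,d\boldsymbol\lambda\rangle=\mathcal Q\langle\boldsymbol\gamma,d\boldsymbol\lambda\rangle+\mathcal P\,d\lambda_3 .$$ Here $\boldsymbol\lambda$ is the left Maurer--Cartan form of $SO(3)$, $d\boldsymbol\lambda=(\lambda_3\wedge\lambda_2,\lambda_1\wedge\lambda_3,\lambda_2\wedge\lambda_1)$, and $\langle\mathcal J,\mathcal K_{\mathcal W}\rangle=\sum_{i=1,2}\Theta_{\mathcal M}(\partial_{a_i})\,d\epsilon^i$ on $\mathcal C$, where $\epsilon=d\boldsymbol a+g(\boldsymbol\lambda\times s)$. 3. Let $f,g$ be functions on $[-1,1]$ such that $f(\gamma_3)$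 and $g(\gamma_3)$ are smooth on $Q$, and let $j_1=-M_3$, $j_2=\langle\boldsymbol\gamma,\mathbf M\rangle$. Then $J=f(\tau_1)j_1+g(\tau_1)j_2$ is a horizontal gauge momentum if and only if $(f,g)$ solves $(*)$. 4. There are two such solutions $(f_1,g_1)$, $(f_2,g_2)$ of $(*)$ with $f_1g_2-f_2g_1\neq0$ on all of $[-1,1]$. The functions $J_i=f_i(\tau_1)j_1+g_i(\tau_1)j_2$, $i=1,2$, are then two linearly independent horizontal gauge momenta. -/

import Mathlib

open scoped Matrix ContDiff

/-- Vectors of `ℝ³`; inner products are `u ⬝ᵥ v` and vector products are `u ⨯₃ v`. -/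
abbrev Vec3 := Fin 3 → ℝ

/-- Ambient space of the configurations `(g, a)`: `g` is the `3 × 3` matrix whose rows are
`α = g 0`, `β = g 1`, `γ = g 2`, and `a` is the position of the centre of mass. -/
abbrev Config := (Fin 3 → Vec3) × Vec3

/-- Ambient space of the phase points `((g, a), M)`. -/
abbrev Phase := Config × Vec3

/-- The Lie algebra `ℝ × ℝ × ℝ²` of `S¹ × E(2)`. -/
abbrev BodySymAlg := ℝ × ℝ × (ℝ × ℝ)

/-- Rotation by the angle `θ` about the third axis. -/
noncomputable def rotZ (θ : ℝ) (v : Vec3) : Vec3 :=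
  ![Real.cos θ * v 0 - Real.sin θ * v 1, Real.sin θ * v 0 + Real.cos θ * v 1, v 2]

/-- The action of `(h_θ; h_φ, (x, y)) ∈ S¹ × E(2)` on configurations,
`(g, a) ↦ (h_φ g h_θ⁻¹, h_φ a + (x, y, 0))`. The rows of `g h_θ⁻¹` are the rows of `g` rotated by
`h_θ`, and `h_φ` acts on the columns. -/
noncomputable def configAct (θ φ x y : ℝ) (q : Config) : Config :=
  (fun i j => rotZ φ (fun k => rotZ θ (q.1 k) j) i, rotZ φ q.2 + ![x, y, 0])

/-- The lifted action on phase points: `M ↦ h_θ M`. -/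
noncomputable def phaseAct (θ φ x y : ℝ) (p : Phase) : Phase :=
  (configAct θ φ x y p.1, rotZ θ p.2)

/-- Infinitesimal generator `ξ_Q` at `q`. -/
noncomputable def configGen (ξ : BodySymAlg) (q : Config) : Config :=
  deriv (fun t : ℝ => configAct (t * ξ.1) (t * ξ.2.1) (t * ξ.2.2.1) (t * ξ.2.2.2) q) 0

/-- Infinitesimal generator `ξ_𝓜` at `p`. -/
noncomputable def phaseGen (ξ : BodySymAlg) (p : Phase) : Phase :=
  deriv (fun t : ℝ => phaseAct (t * ξ.1) (t * ξ.2.1) (t * ξ.2.2.1) (t * ξ.2.2.2) p) 0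

/-- Left Maurer-Cartan form: if the rows of `δg` are `g i ⨯₃ u` (that is, `δg = g û` with `û` the skew matrix of `u ∈ ℝ³`) with
`g ∈ SO(3)`, the value is `u`. -/
noncomputable def mcForm (g δg : Fin 3 → Vec3) : Vec3 :=
  -(1 / 2 : ℝ) • ∑ i, g i ⨯₃ δg i

/-- The matrix `g` acting on a vector. -/
def rowsMul (g : Fin 3 → Vec3) (v : Vec3) : Vec3 := fun i => g i ⬝ᵥ v

/-- Exterior derivative of a one-form `η` on the ambient space, `η p w` being linear in `w`. -/
noncomputable def dOneForm (η : Phase → Phase → ℝ) (p v w : Phase) : ℝ :=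
  fderiv ℝ (fun p' => η p' w) p v - fderiv ℝ (fun p' => η p' v) p w

/-- The point `s(γ)` of a surface of revolution with profile functions `ϱ`, `ζ`. -/
def revolutionPoint (ϱ ζ : ℝ → ℝ) (γ : Vec3) : Vec3 :=
  ![ϱ (γ 2) * γ 0, ϱ (γ 2) * γ 1, ζ (γ 2)]

/-- A strongly convex body of revolution. The map `s` with
`s(γ) = (ϱ(γ₃) γ₁, ϱ(γ₃) γ₂, ζ(γ₃))`, `γ ∈ S²`, is the inverse of the Gauss map of its surface:
`γ` is orthogonal to the surface at `s(γ)`, and the surface is strongly convex with inward normal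
`γ`, i.e. `ds` is negative definite on `T_γ S²`. A smooth function of `γ₃ ∈ [-1, 1]` is the
restriction of one that is smooth near `[-1, 1]`; the values of `ϱ`, `ζ` off `[-1, 1]` play no role.
The gravitational strength `grav` is arbitrary. -/
structure RollingBody where
  m : ℝ
  I₁ : ℝ
  I₃ : ℝ
  grav : ℝ
  ϱ : ℝ → ℝ
  ζ : ℝ → ℝ
  m_pos : 0 < m
  I₁_pos : 0 < I₁
  I₃_pos : 0 < I₃
  ϱ_smooth : ∀ z ∈ Set.Icc (-1 : ℝ) 1, ContDiffAt ℝ ∞ ϱ z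
  ζ_smooth : ∀ z ∈ Set.Icc (-1 : ℝ) 1, ContDiffAt ℝ ∞ ζ z
  normal : ∀ γ δ : Vec3, γ ⬝ᵥ γ = 1 → γ ⬝ᵥ δ = 0 →
    γ ⬝ᵥ fderiv ℝ (revolutionPoint ϱ ζ) γ δ = 0
  convex : ∀ γ δ : Vec3, γ ⬝ᵥ γ = 1 → γ ⬝ᵥ δ = 0 → δ ≠ 0 →
    δ ⬝ᵥ fderiv ℝ (revolutionPoint ϱ ζ) γ δ < 0

namespace RollingBody

variable (B : RollingBody)

/-- The vector from the centre of mass to the contact point, in body coordinates. -/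
def s (γ : Vec3) : Vec3 := revolutionPoint B.ϱ B.ζ γ

/-- The inertia tensor `diag(I₁, I₁, I₃)`. -/
def inertia (u : Vec3) : Vec3 := ![B.I₁ * u 0, B.I₁ * u 1, B.I₃ * u 2]

/-- The configuration manifold: `g ∈ SO(3)` and `a₃ = -⟨γ, s(γ)⟩`. -/
def Q : Set Config :=
  {q | Matrix.of q.1 ∈ Matrix.specialOrthogonalGroup (Fin 3) ℝ ∧ q.2 2 = -(q.1 2 ⬝ᵥ B.s (q.1 2))}

/-- The constraint distribution: `δg = g û` and `δa = -g (u × s)`. -/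
def D (q : Config) : Set Config :=
  {v | ∃ u : Vec3, v = (fun i => q.1 i ⨯₃ u, -rowsMul q.1 (u ⨯₃ B.s (q.1 2)))}

/-- The diagonal entries of `A = 𝕀 + m ⟨s, s⟩ Id`. -/
def diagA (γ : Vec3) : Vec3 :=
  ![B.I₁ + B.m * (B.s γ ⬝ᵥ B.s γ), B.I₁ + B.m * (B.s γ ⬝ᵥ B.s γ), B.I₃ + B.m * (B.s γ ⬝ᵥ B.s γ)]

/-- The angular velocity `Ω` as a function of `γ` and `M`: the solution of
`M = 𝕀 Ω + m s × (Ω × s)`, see `momentum_angVel`. -/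
noncomputable def angVel (γ M : Vec3) : Vec3 :=
  let u : Vec3 := fun i => M i / B.diagA γ i
  let w : Vec3 := fun i => B.s γ i / B.diagA γ i
  u + (B.m * ((u ⬝ᵥ B.s γ) / (1 - B.m * (w ⬝ᵥ B.s γ)))) • w

theorem momentum_angVel (γ M : Vec3) :
    B.inertia (B.angVel γ M) + B.m • (B.s γ ⨯₃ (B.angVel γ M ⨯₃ B.s γ)) = M := by
  have hm := B.m_pos
  have h1 := B.I₁_pos
  have h3 := B.I₃_pos
  have dot3 : ∀ u v : Vec3, u ⬝ᵥ v = u 0 * v 0 + u 1 * v 1 + u 2 * v 2 := fun u v => by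
    simp [dotProduct, Fin.sum_univ_three]
  set x := B.s γ 0 with hx
  set y := B.s γ 1 with hy
  set z := B.s γ 2 with hz
  obtain ⟨N, hN⟩ : ∃ N, N = x * x + y * y + z * z := ⟨_, rfl⟩
  have hss : B.s γ ⬝ᵥ B.s γ = N := by rw [dot3, hN]
  have hN0 : 0 ≤ N := by rw [hN]; nlinarith [mul_self_nonneg x, mul_self_nonneg y, mul_self_nonneg z]
  obtain ⟨a, ha⟩ : ∃ a, a = B.I₁ + B.m * N := ⟨_, rfl⟩
  obtain ⟨c, hc⟩ : ∃ c, c = B.I₃ + B.m * N := ⟨_, rfl⟩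
  have ha0 : 0 < a := by rw [ha]; positivity
  have hc0 : 0 < c := by rw [hc]; positivity
  obtain ⟨E, hE⟩ : ∃ E, E = 1 - B.m * (x / a * x + y / a * y + z / c * z) := ⟨_, rfl⟩
  have hEac : E * (a * c) = B.I₁ * B.I₃ + B.m * B.I₁ * (x * x + y * y) + B.m * B.I₃ * (z * z) := by
    rw [hE]
    field_simp
    rw [ha, hc, hN]
    ring
  have hE0 : E ≠ 0 := by
    intro h
    rw [h, zero_mul] at hEac
    have hxy : 0 ≤ x * x + y * y := add_nonneg (mul_self_nonneg x) (mul_self_nonneg y)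
    have hzz : 0 ≤ z * z := mul_self_nonneg z
    have : 0 < B.I₁ * B.I₃ + B.m * B.I₁ * (x * x + y * y) + B.m * B.I₃ * (z * z) := by positivity
    linarith
  obtain ⟨k, hk⟩ : ∃ k, k = (M 0 / a * x + M 1 / a * y + M 2 / c * z) / E := ⟨_, rfl⟩
  have hkE : k * E = M 0 / a * x + M 1 / a * y + M 2 / c * z := by rw [hk]; field_simp
  have A0 : B.diagA γ 0 = a := by simp [diagA, hss, ha]
  have A1 : B.diagA γ 1 = a := by simp [diagA, hss, ha]
  have A2 : B.diagA γ 2 = c := by simp [diagA, hss, hc]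
  have o0 : B.angVel γ M 0 = (M 0 + B.m * k * x) / a := by
    simp only [angVel, Pi.add_apply, Pi.smul_apply, smul_eq_mul, dot3, A0, A1, A2, ← hx, ← hy, ← hz]
    rw [← hE, ← hk]; ring
  have o1 : B.angVel γ M 1 = (M 1 + B.m * k * y) / a := by
    simp only [angVel, Pi.add_apply, Pi.smul_apply, smul_eq_mul, dot3, A0, A1, A2, ← hx, ← hy, ← hz]
    rw [← hE, ← hk]; ring
  have o2 : B.angVel γ M 2 = (M 2 + B.m * k * z) / c := by
    simp only [angVel, Pi.add_apply, Pi.smul_apply, smul_eq_mul, dot3, A0, A1, A2, ← hx, ← hy, ← hz]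
    rw [← hE, ← hk]; ring
  have hdot : x * B.angVel γ M 0 + y * B.angVel γ M 1 + z * B.angVel γ M 2 = k := by
    rw [o0, o1, o2]
    have : k * (1 - E) = B.m * k * (x / a * x + y / a * y + z / c * z) := by rw [hE]; ring
    linear_combination -hkE - this
  have e0 : a * B.angVel γ M 0 = M 0 + B.m * k * x := by rw [o0]; field_simp
  have e1 : a * B.angVel γ M 1 = M 1 + B.m * k * y := by rw [o1]; field_simp
  have e2 : c * B.angVel γ M 2 = M 2 + B.m * k * z := by rw [o2]; field_simp
  rw [ha, hN] at e0 e1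
  rw [hc, hN] at e2
  ext i
  fin_cases i
  · simp [inertia, cross_apply, ← hx, ← hy, ← hz]
    linear_combination e0 - B.m * x * hdot
  · simp [inertia, cross_apply, ← hx, ← hy, ← hz]
    linear_combination e1 - B.m * y * hdot
  · simp [inertia, cross_apply, ← hx, ← hy, ← hz]
    linear_combination e2 - B.m * z * hdot

/-- The constraint submanifold `𝓜 = κ♭(D)`. A point `(g, a, M)` stands for the covector
`κ♭(v)` at `(g, a)`, where `v ∈ D` has angular velocity `Ω = angVel γ M`; the `M_i` are its
components along the basis of `D` given by `u = e_i`. -/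
def phase : Set Phase := {p | p.1 ∈ B.Q}

/-- The angular velocity at a phase point. -/
noncomputable def Ω (p : Phase) : Vec3 := B.angVel (p.1.1 2) p.2

/-- The velocity `-g (Ω × s)` of the centre of mass at a phase point. -/
noncomputable def centreVel (p : Phase) : Vec3 :=
  -rowsMul p.1.1 (B.Ω p ⨯₃ B.s (p.1.1 2))

/-- The distribution `𝓒` on `𝓜` of the tangent vectors that project into `D`; they are
determined by `u` and `δM`. (Vectors of `D` are tangent to `Q`, since `γ` is normal to the surface.) -/
def C (p : Phase) : Set Phase := {v | v.1 ∈ B.D p.1}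

/-- The Liouville form `Θ_𝓜`: the covector `κ♭(v)` applied to the projection of `w` to `TQ`, for the
kinetic energy metric `κ`. -/
noncomputable def liouville (p w : Phase) : ℝ :=
  B.inertia (B.Ω p) ⬝ᵥ mcForm p.1.1 w.1.1 + B.m * (B.centreVel p ⬝ᵥ w.1.2)

/-- The two-form `Ω_𝓜 = -dΘ_𝓜`. On tangent vectors of `𝓜` it does not depend on how `Θ_𝓜` is extended
to the ambient space. -/
noncomputable def symplectic (p v w : Phase) : ℝ := -dOneForm B.liouville p v w

/-- The Hamiltonian: kinetic energy plus `m grav a₃`. -/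
noncomputable def hamiltonian (p : Phase) : ℝ :=
  (1 / 2) * (B.inertia (B.Ω p) ⬝ᵥ B.Ω p) + (1 / 2) * B.m * (B.centreVel p ⬝ᵥ B.centreVel p)
    + B.m * B.grav * p.1.2 2

/-- `v` is the value at `p` of the nonholonomic vector field: `v ∈ 𝓒` and
`i_v Ω_𝓜 = dH` on `𝓒`. -/
def IsNonholonomicVector (p v : Phase) : Prop :=
  v ∈ B.C p ∧ ∀ w ∈ B.C p, B.symplectic p v w = fderiv ℝ B.hamiltonian p w

/-- The nonholonomic vector field `X_nh` on `𝓜`. -/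
noncomputable def Xnh (p : Phase) : Phase := Classical.epsilon (B.IsNonholonomicVector p)

/-- The fibre at `q` of `𝔤_S = {ξ | ξ_Q(q) ∈ D_q ∩ V_q}`, where `V_q` is the tangent space of the
group orbit. -/
def gS (q : Config) : Set BodySymAlg :=
  {ξ | configGen ξ q ∈ B.D q ∩ Set.range fun η : BodySymAlg => configGen η q}

/-- `J` is a horizontal gauge momentum of `X_nh`: a smooth function on `𝓜` of the form
`Θ_𝓜(χ_𝓜)` for a smooth section `χ` of `𝔤_S`, with `X_nh(J) = 0`. -/
def IsHorizontalGaugeMomentum (J : Phase → ℝ) : Prop :=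
  ContDiffOn ℝ ∞ J B.phase ∧
  (∃ χ : Config → BodySymAlg, ContDiffOn ℝ ∞ χ B.Q ∧ (∀ q ∈ B.Q, χ q ∈ B.gS q) ∧
    ∀ p ∈ B.phase, J p = B.liouville p (phaseGen (χ p.1) p)) ∧
  ∀ p ∈ B.phase, fderivWithin ℝ J B.phase p (B.Xnh p) = 0

/-- `L(γ₃) = ϱ γ₃ - ζ`. -/
def L (z : ℝ) : ℝ := B.ϱ z * z - B.ζ z

/-- `σ = m ⟨s, γ⟩` as a function of `γ₃`. -/
def σ (z : ℝ) : ℝ := B.m * (B.ϱ z * (1 - z ^ 2) + B.ζ z * z)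

/-- `P = I₁ I₃ + m ⟨𝕀 s, s⟩` as a function of `γ₃`. -/
def P (z : ℝ) : ℝ :=
  B.I₁ * B.I₃ + B.m * (B.I₁ * B.ϱ z ^ 2 * (1 - z ^ 2) + B.I₃ * B.ζ z ^ 2)

/-- The matrix `[𝒬𝒫]` as a function of `τ₁ = γ₃`. -/
noncomputable def QP (z : ℝ) : Matrix (Fin 2) (Fin 2) ℝ :=
  (B.m / B.P z) •
    !![B.I₃ * (-B.ϱ z ^ 2 - deriv B.ϱ z * B.ζ z) - B.ϱ z ^ 3 * B.σ z,
       -B.ϱ z * B.I₁ * (B.ϱ z * z - deriv B.ϱ z * (1 - z ^ 2)) - B.ϱ z ^ 2 * B.ζ z * B.σ z;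
       B.I₃ * (B.ϱ z * B.L z + deriv B.L z * B.ζ z) + B.ϱ z ^ 2 * B.L z * B.σ z,
       B.ϱ z * B.I₁ * (B.L z * z - deriv B.L z * (1 - z ^ 2)) + B.ϱ z * B.ζ z * B.L z * B.σ z]

/-- The vector `(𝒬, 𝒫) = [𝒬𝒫] (τ₃, τ₄)` at a phase point, with `τ₃ = γ₁ M₁ + γ₂ M₂` and
`τ₄ = M₃`. -/
noncomputable def qpVec (p : Phase) : Fin 2 → ℝ :=
  B.QP (p.1.1 2 2) *ᵥ ![p.1.1 2 0 * p.2 0 + p.1.1 2 1 * p.2 1, p.2 2]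

/-- The constraint one-forms `ε¹`, `ε²` (for `i = 0, 1`), `ε = da + g (λ × s)`; they are the
components of the connection whose horizontal space is `𝓒` and whose vertical space is spanned by
`∂/∂a₁` and `∂/∂a₂`. -/
noncomputable def constraintForm (i : Fin 3) (p w : Phase) : ℝ :=
  w.1.2 i + rowsMul p.1.1 (mcForm p.1.1 w.1.1 ⨯₃ B.s (p.1.1 2)) i

/-- The two-form `⟨𝒥, 𝒦_𝓦⟩` on `𝓒`: the sum of `Θ_𝓜(∂/∂a_i) dε^i` over the two translations. -/
noncomputable def JK (p v w : Phase) : ℝ :=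
  ∑ i ∈ ({0, 1} : Finset (Fin 3)),
    B.liouville p ((0, Pi.single i 1), 0) * dOneForm (B.constraintForm i) p v w

/-- The pair `(f, g)` of functions of `τ₁ ∈ [-1, 1]` solves
`(f', g')ᵀ = [[τ₁, -1], [1, 0]] [𝒬𝒫]ᵀ (f, g)ᵀ`. -/
def IsSolution (f g : ℝ → ℝ) : Prop :=
  ∀ z ∈ Set.Icc (-1 : ℝ) 1,
    HasDerivWithinAt (fun t => ![f t, g t])
      (!![z, -1; 1, 0] *ᵥ ((B.QP z)ᵀ *ᵥ ![f z, g z])) (Set.Icc (-1) 1) z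

/-- The function `f` of `τ₁ = γ₃` is a smooth (invariant) function on `Q`. -/
def SmoothOnQ (f : ℝ → ℝ) : Prop := ContDiffOn ℝ ∞ (fun q : Config => f (q.1 2 2)) B.Q

end RollingBody

/-- `j₁ = -M₃`. -/
def j₁ (p : Phase) : ℝ := -p.2 2

/-- `j₂ = ⟨γ, M⟩`. -/
def j₂ (p : Phase) : ℝ := p.1.1 2 ⬝ᵥ p.2

/-- `J = f(τ₁) j₁ + g(τ₁) j₂` with `τ₁ = γ₃`. -/
def gaugeCombination (f g : ℝ → ℝ) (p : Phase) : ℝ := f (p.1.1 2 2) * j₁ p + g (p.1.1 2 2) * j₂ p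

/-! A vector of `𝓒` is a pair `(u, N)`: an angular velocity and a variation of `M`. Differentiating
`M = 𝕀Ω + m s × (Ω × s)` eliminates every derivative of `Ω` from `Ω_𝓜` restricted to `𝓒`. What
remains is the canonical pairing `u·N' - u'·N` plus a term in `u, u'` alone, so the form is
nondegenerate. Comparison with `dH` forces `u = Ω` and determines `N`, the equation of motion for
`M` (`isNonholonomicVector_iff`).

That `γ` is normal to the surface leaves one free derivative: `ϱ' = γ₃ L'` and `ζ' = ϱ - (1 - γ₃²)
L'`. Hence `δs = ϱ δγ + L' δγ₃ (γ₃ γ - e₃)`, and the curvature of the constraints depends on `u, u'`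
only through `u' × u`, which is `dλ`. This gives the identity for `𝒬` and `𝒫` (`JK_identity`).

The same `𝒬` and `𝒫` govern the motion: along `X_nh` one has `Ṁ₃ = γ̇₃ 𝒬` and `d⟨γ, M⟩/dt = -γ̇₃ 𝒫`
(`momentumRate_two`, `dot_momentumRate`). Therefore the rate of `J = f j₁ + g j₂` is `γ̇₃ (f' j₁ +
g' j₂ - f 𝒬 - g 𝒫)`. The bracket is linear in `(τ₃, τ₄)`, with `j₁ = -τ₄` and `j₂ = τ₃ + γ₃ τ₄`, and
the vanishing of its two coefficients is the system `(∗)`. Any `f, g` define a section of `𝔤_S`,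
because a horizontal translation can compensate the rotational part, so conservation is the only
condition.

The coefficients of `(∗)` are regular up to `±1`. Linear ODE theory then yields two solutions, and
Liouville's formula keeps their Wronskian away from zero. -/

/-! ### Vector algebra and orthonormal frames. -/

theorem Vec3.dot_eq (u v : Vec3) : u ⬝ᵥ v = u 0 * v 0 + u 1 * v 1 + u 2 * v 2 := by
  simp [dotProduct, Fin.sum_univ_three]

theorem Vec3.cross_zero (u v : Vec3) : (u ⨯₃ v) 0 = u 1 * v 2 - u 2 * v 1 := by
  simp [cross_apply]

theorem Vec3.cross_one (u v : Vec3) : (u ⨯₃ v) 1 = u 2 * v 0 - u 0 * v 2 := by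
  simp [cross_apply]

theorem Vec3.cross_two (u v : Vec3) : (u ⨯₃ v) 2 = u 0 * v 1 - u 1 * v 0 := by
  simp [cross_apply]

theorem Vec3.ext_coord {u v : Vec3} (h0 : u 0 = v 0) (h1 : u 1 = v 1) (h2 : u 2 = v 2) :
    u = v := by
  ext i; fin_cases i <;> assumption

/-- The rows of `g` form a positively oriented orthonormal frame. -/
abbrev IsRot (g : Fin 3 → Vec3) : Prop :=
  Matrix.of g ∈ Matrix.specialOrthogonalGroup (Fin 3) ℝ

theorem IsRot.col {g : Fin 3 → Vec3} (hg : IsRot g) (j k : Fin 3) :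
    g 0 j * g 0 k + g 1 j * g 1 k + g 2 j * g 2 k = if j = k then 1 else 0 := by
  have h := (Matrix.mem_orthogonalGroup_iff' (Fin 3) ℝ).1
    (Matrix.mem_specialOrthogonalGroup_iff.1 hg).1
  have := congrFun (congrFun h j) k
  simpa [Matrix.mul_apply, Fin.sum_univ_three, Matrix.one_apply] using this

theorem IsRot.row {g : Fin 3 → Vec3} (hg : IsRot g) (i j : Fin 3) :
    g i ⬝ᵥ g j = if i = j then 1 else 0 := by
  have h := (Matrix.mem_orthogonalGroup_iff (Fin 3) ℝ).1
    (Matrix.mem_specialOrthogonalGroup_iff.1 hg).1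
  have := congrFun (congrFun h i) j
  simpa [Matrix.mul_apply, Fin.sum_univ_three, Matrix.one_apply, dotProduct] using this

theorem IsRot.third_dot_self {g : Fin 3 → Vec3} (hg : IsRot g) : g 2 ⬝ᵥ g 2 = 1 := by
  simpa using hg.row 2 2

theorem IsRot.third_mem_Icc {g : Fin 3 → Vec3} (hg : IsRot g) : g 2 2 ∈ Set.Icc (-1 : ℝ) 1 := by
  have h := hg.third_dot_self
  rw [Vec3.dot_eq] at h
  constructor <;> nlinarith [mul_self_nonneg (g 2 0), mul_self_nonneg (g 2 1)]

theorem mcForm_coord (g δ : Fin 3 → Vec3) :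
    mcForm g δ = -(1 / 2 : ℝ) • (g 0 ⨯₃ δ 0 + g 1 ⨯₃ δ 1 + g 2 ⨯₃ δ 2) := by
  simp [mcForm, Fin.sum_univ_three]

/-- Column orthonormality says `∑ gᵢ ⟨gᵢ, u⟩ = u`, so `∑ gᵢ × (gᵢ × u) = u - 3u`, which the factor
`-1/2` normalises. -/
theorem IsRot.mcForm_cross {g : Fin 3 → Vec3} (hg : IsRot g) (u : Vec3) :
    mcForm g (fun i => g i ⨯₃ u) = u := by
  have c := hg.col
  have c00 := c 0 0; have c01 := c 0 1; have c02 := c 0 2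
  have c11 := c 1 1; have c12 := c 1 2; have c22 := c 2 2
  simp at c00 c01 c02 c11 c12 c22
  rw [mcForm_coord]
  apply Vec3.ext_coord <;>
    simp only [Pi.smul_apply, Pi.add_apply, smul_eq_mul, Vec3.cross_zero, Vec3.cross_one,
      Vec3.cross_two]
  · linear_combination (1 / 2 * u 0) * (c11 + c22) - 1 / 2 * u 1 * c01 - 1 / 2 * u 2 * c02
  · linear_combination (1 / 2 * u 1) * (c00 + c22) - 1 / 2 * u 0 * c01 - 1 / 2 * u 2 * c12
  · linear_combination (1 / 2 * u 2) * (c00 + c11) - 1 / 2 * u 0 * c02 - 1 / 2 * u 1 * c12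

/-- Since `mcForm` is linear in the frame, this is its derivative along `𝓒`. Antisymmetrised, it is
the Maurer–Cartan equation in the form `dλ(v, w) = λ(w) × λ(v)`. -/
theorem IsRot.mcForm_cross_cross {g : Fin 3 → Vec3} (hg : IsRot g) (u v : Vec3) :
    mcForm (fun i => g i ⨯₃ u) (fun i => g i ⨯₃ v) = -(1 / 2 : ℝ) • (u ⨯₃ v) := by
  have c := hg.col
  have c00 := c 0 0; have c01 := c 0 1; have c02 := c 0 2
  have c11 := c 1 1; have c12 := c 1 2; have c22 := c 2 2
  simp at c00 c01 c02 c11 c12 c22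
  rw [mcForm_coord]
  congr 1
  apply Vec3.ext_coord <;>
    simp only [Pi.add_apply, Vec3.cross_zero, Vec3.cross_one, Vec3.cross_two]
  · linear_combination (u 1 * v 2 - u 2 * v 1) * c00 + (u 2 * v 0 - u 0 * v 2) * c01
      + (u 0 * v 1 - u 1 * v 0) * c02
  · linear_combination (u 1 * v 2 - u 2 * v 1) * c01 + (u 2 * v 0 - u 0 * v 2) * c11
      + (u 0 * v 1 - u 1 * v 0) * c12
  · linear_combination (u 1 * v 2 - u 2 * v 1) * c02 + (u 2 * v 0 - u 0 * v 2) * c12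
      + (u 0 * v 1 - u 1 * v 0) * c22

theorem IsRot.rowsMul_dot {g : Fin 3 → Vec3} (hg : IsRot g) (u v : Vec3) :
    rowsMul g u ⬝ᵥ rowsMul g v = u ⬝ᵥ v := by
  have c := hg.col
  have c00 := c 0 0; have c01 := c 0 1; have c02 := c 0 2
  have c11 := c 1 1; have c12 := c 1 2; have c22 := c 2 2
  simp at c00 c01 c02 c11 c12 c22
  simp only [rowsMul, Vec3.dot_eq]
  linear_combination u 0 * v 0 * c00 + u 1 * v 1 * c11 + u 2 * v 2 * c22
    + (u 0 * v 1 + u 1 * v 0) * c01 + (u 0 * v 2 + u 2 * v 0) * c02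
    + (u 1 * v 2 + u 2 * v 1) * c12

theorem rowsMul_cross (g : Fin 3 → Vec3) (u v : Vec3) :
    rowsMul (fun i => g i ⨯₃ u) v = rowsMul g (u ⨯₃ v) := by
  ext i
  simp only [rowsMul, Vec3.dot_eq, Vec3.cross_zero, Vec3.cross_one, Vec3.cross_two]
  ring

theorem rowsMul_add (g : Fin 3 → Vec3) (u v : Vec3) :
    rowsMul g (u + v) = rowsMul g u + rowsMul g v := by
  ext i; simp [rowsMul, dotProduct_add]

theorem mcForm_zero (g : Fin 3 → Vec3) : mcForm g 0 = 0 := by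
  simp [mcForm_coord]

/-! ### Curves in the rotation group. -/

/-- The Cayley parametrisation of rotations: right multiplication of a row by the rotation with
Rodrigues vector `(t / 2) u`. -/
noncomputable def cayleyRow (u : Vec3) (t : ℝ) (r : Vec3) : Vec3 :=
  r + (t / (1 + t ^ 2 / 4 * (u ⬝ᵥ u))) • (r ⨯₃ u)
    + (t ^ 2 / 2 / (1 + t ^ 2 / 4 * (u ⬝ᵥ u))) • ((r ⨯₃ u) ⨯₃ u)

theorem cayleyRow_zero (u r : Vec3) : cayleyRow u 0 r = r := by simp [cayleyRow]

theorem hasDerivAt_cayleyRow (u r : Vec3) :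
    HasDerivAt (fun t => cayleyRow u t r) (r ⨯₃ u) 0 := by
  have hd : ∀ n : ℝ, HasDerivAt (fun t : ℝ => 1 + t ^ 2 / 4 * n) 0 0 := fun n => by
    have := ((((hasDerivAt_id (0 : ℝ)).pow 2).div_const 4).mul_const n).const_add 1
    simpa using this
  have h1 : HasDerivAt (fun t : ℝ => t / (1 + t ^ 2 / 4 * (u ⬝ᵥ u))) 1 0 := by
    have := (hasDerivAt_id (0 : ℝ)).fun_div (hd (u ⬝ᵥ u)) (by simp)
    simpa using this
  have h2 : HasDerivAt (fun t : ℝ => t ^ 2 / 2 / (1 + t ^ 2 / 4 * (u ⬝ᵥ u))) 0 0 := by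
    have := (((hasDerivAt_id (0 : ℝ)).pow 2).div_const 2).fun_div (hd (u ⬝ᵥ u)) (by simp)
    simpa using this
  have := ((h1.smul_const (r ⨯₃ u)).const_add r).fun_add (h2.smul_const ((r ⨯₃ u) ⨯₃ u))
  simpa [cayleyRow] using this

theorem IsRot.cayleyRow {g : Fin 3 → Vec3} (hg : IsRot g) (u : Vec3) (t : ℝ) :
    IsRot (fun i => cayleyRow u t (g i)) := by
  set n := u ⬝ᵥ u with hn
  have hnn : n = u 0 * u 0 + u 1 * u 1 + u 2 * u 2 := by rw [hn, Vec3.dot_eq]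
  have hn0 : 0 ≤ n := by
    rw [hnn]; nlinarith [mul_self_nonneg (u 0), mul_self_nonneg (u 1), mul_self_nonneg (u 2)]
  have hd : 1 + t ^ 2 / 4 * n ≠ 0 := by positivity
  -- With the inverse denominator `d` as a letter, orthogonality and the determinant become
  -- polynomial identities modulo the single relation `hdd`.
  obtain ⟨d, hd'⟩ : ∃ d, d = (1 + t ^ 2 / 4 * n)⁻¹ := ⟨_, rfl⟩
  have hdd : d * (1 + t ^ 2 / 4 * n) = 1 := by rw [hd']; field_simp
  rw [hnn] at hdd
  set R : Matrix (Fin 3) (Fin 3) ℝ := Matrix.of fun i => _root_.cayleyRow u t (Pi.single i 1)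
    with hR
  have key : Matrix.of (fun i => _root_.cayleyRow u t (g i)) = Matrix.of g * R := by
    ext i j
    rw [hR, Matrix.mul_apply, Fin.sum_univ_three]
    fin_cases j <;>
    simp [_root_.cayleyRow, Vec3.cross_zero, Vec3.cross_one, Vec3.cross_two] <;> ring
  have entries : R = !![
      1 - t ^ 2 / 2 * d * (u 1 ^ 2 + u 2 ^ 2), -(t * d * u 2) + t ^ 2 / 2 * d * (u 0 * u 1),
        t * d * u 1 + t ^ 2 / 2 * d * (u 0 * u 2);
      t * d * u 2 + t ^ 2 / 2 * d * (u 0 * u 1), 1 - t ^ 2 / 2 * d * (u 0 ^ 2 + u 2 ^ 2),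
        -(t * d * u 0) + t ^ 2 / 2 * d * (u 1 * u 2);
      -(t * d * u 1) + t ^ 2 / 2 * d * (u 0 * u 2), t * d * u 0 + t ^ 2 / 2 * d * (u 1 * u 2),
        1 - t ^ 2 / 2 * d * (u 0 ^ 2 + u 1 ^ 2)] := by
    ext i j
    rw [hR, hd']
    fin_cases i <;> fin_cases j <;>
    simp [_root_.cayleyRow, Vec3.cross_zero, Vec3.cross_one, Vec3.cross_two, ← hn,
        div_eq_mul_inv, -mul_eq_mul_left_iff, -mul_eq_mul_right_iff] <;> ring
  have hRmem : R ∈ Matrix.specialOrthogonalGroup (Fin 3) ℝ := by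
    rw [Matrix.mem_specialOrthogonalGroup_iff, Matrix.mem_orthogonalGroup_iff, entries]
    constructor
    · ext i j
      fin_cases i <;> fin_cases j <;>
        simp [Matrix.mul_apply, Fin.sum_univ_three, -mul_eq_mul_left_iff,
          -mul_eq_mul_right_iff]
      · linear_combination t ^ 2 * d * ((u 0 * u 0 + u 1 * u 1 + u 2 * u 2) - u 0 * u 0) * hdd
      · linear_combination t ^ 2 * d * (0 - u 0 * u 1) * hdd
      · linear_combination t ^ 2 * d * (0 - u 0 * u 2) * hdd
      · linear_combination t ^ 2 * d * (0 - u 1 * u 0) * hdd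
      · linear_combination t ^ 2 * d * ((u 0 * u 0 + u 1 * u 1 + u 2 * u 2) - u 1 * u 1) * hdd
      · linear_combination t ^ 2 * d * (0 - u 1 * u 2) * hdd
      · linear_combination t ^ 2 * d * (0 - u 2 * u 0) * hdd
      · linear_combination t ^ 2 * d * (0 - u 2 * u 1) * hdd
      · linear_combination t ^ 2 * d * ((u 0 * u 0 + u 1 * u 1 + u 2 * u 2) - u 2 * u 2) * hdd
    · rw [Matrix.det_fin_three]
      simp
      linear_combination t ^ 2 * d * (u 0 * u 0 + u 1 * u 1 + u 2 * u 2) * hdd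
  unfold IsRot
  rw [key]
  exact mul_mem hg hRmem

/-! ### Derivatives along lines and product rules. -/

section calculus

variable {E : Type*} [NormedAddCommGroup E] [NormedSpace ℝ E]

theorem DifferentiableAt.dotVec3 {A B : E → Vec3} {x : E} (hA : DifferentiableAt ℝ A x)
    (hB : DifferentiableAt ℝ B x) : DifferentiableAt ℝ (fun y => A y ⬝ᵥ B y) x := by
  have a := differentiableAt_pi.1 hA
  have b := differentiableAt_pi.1 hB
  simp only [Vec3.dot_eq]
  exact (((a 0).mul (b 0)).add ((a 1).mul (b 1))).add ((a 2).mul (b 2))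

theorem DifferentiableAt.crossVec3 {A B : E → Vec3} {x : E} (hA : DifferentiableAt ℝ A x)
    (hB : DifferentiableAt ℝ B x) : DifferentiableAt ℝ (fun y => A y ⨯₃ B y) x := by
  have a := differentiableAt_pi.1 hA
  have b := differentiableAt_pi.1 hB
  refine differentiableAt_pi.2 fun i => ?_
  fin_cases i
  · simpa only [Fin.zero_eta, Vec3.cross_zero] using
      ((a 1).fun_mul (b 2)).fun_sub ((a 2).fun_mul (b 1))
  · simpa only [Fin.mk_one, Vec3.cross_one] using
      ((a 2).fun_mul (b 0)).fun_sub ((a 0).fun_mul (b 2))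
  · simpa only [Fin.reduceFinMk, Vec3.cross_two] using
      ((a 0).fun_mul (b 1)).fun_sub ((a 1).fun_mul (b 0))

theorem DifferentiableAt.divReal {a b : E → ℝ} {x : E} (ha : DifferentiableAt ℝ a x)
    (hb : DifferentiableAt ℝ b x) (h0 : b x ≠ 0) : DifferentiableAt ℝ (fun y => a y / b y) x := by
  simp only [div_eq_mul_inv]
  exact ha.mul (hb.inv h0)

theorem HasDerivAt.dotVec3 {A B : ℝ → Vec3} {A' B' : Vec3} {t : ℝ} (hA : HasDerivAt A A' t)
    (hB : HasDerivAt B B' t) :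
    HasDerivAt (fun y => A y ⬝ᵥ B y) (A' ⬝ᵥ B t + A t ⬝ᵥ B') t := by
  have a := hasDerivAt_pi.1 hA
  have b := hasDerivAt_pi.1 hB
  simp only [Vec3.dot_eq]
  refine ((((a 0).mul (b 0)).add ((a 1).mul (b 1))).add ((a 2).mul (b 2))).congr_deriv ?_
  ring

theorem HasDerivAt.crossVec3 {A B : ℝ → Vec3} {A' B' : Vec3} {t : ℝ} (hA : HasDerivAt A A' t)
    (hB : HasDerivAt B B' t) :
    HasDerivAt (fun y => A y ⨯₃ B y) (A' ⨯₃ B t + A t ⨯₃ B') t := by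
  have a := hasDerivAt_pi.1 hA
  have b := hasDerivAt_pi.1 hB
  refine hasDerivAt_pi.2 fun i => ?_
  fin_cases i
  · simp only [Fin.zero_eta, Vec3.cross_zero, Pi.add_apply]
    refine (((a 1).mul (b 2)).sub ((a 2).mul (b 1))).congr_deriv ?_
    ring
  · simp only [Fin.mk_one, Vec3.cross_one, Pi.add_apply]
    refine (((a 2).mul (b 0)).sub ((a 0).mul (b 2))).congr_deriv ?_
    ring
  · simp only [Fin.reduceFinMk, Vec3.cross_two, Pi.add_apply]
    refine (((a 0).mul (b 1)).sub ((a 1).mul (b 0))).congr_deriv ?_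
    ring

theorem hasDerivAt_line (p v : E) : HasDerivAt (fun t : ℝ => p + t • v) v 0 := by
  simpa using ((hasDerivAt_id (0 : ℝ)).smul_const v).const_add p

theorem DifferentiableAt.hasDerivAt_line {F : Type*} [NormedAddCommGroup F] [NormedSpace ℝ F]
    {f : E → F} {p : E} (hf : DifferentiableAt ℝ f p) (v : E) :
    HasDerivAt (fun t : ℝ => f (p + t • v)) (fderiv ℝ f p v) 0 :=
  HasFDerivAt.comp_hasDerivAt_of_eq 0 hf.hasFDerivAt (_root_.hasDerivAt_line p v) (by simp)

/-- All Fréchet derivatives of the forms and of the Hamiltonian are reduced to one variable this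
way. The straight line may leave the manifold, which is harmless for functions differentiable in the
ambient space. -/
theorem HasDerivAt.fderiv_eq {F : Type*} [NormedAddCommGroup F] [NormedSpace ℝ F]
    {f : E → F} {p v : E} {f' : F} (h : HasDerivAt (fun t : ℝ => f (p + t • v)) f' 0)
    (hf : DifferentiableAt ℝ f p) : fderiv ℝ f p v = f' :=
  (hf.hasDerivAt_line v).unique h

end calculus

/-! ### The profile functions and the angular velocity. -/

namespace RollingBody

variable (B : RollingBody)

theorem s_zero (γ : Vec3) : B.s γ 0 = B.ϱ (γ 2) * γ 0 := rfl
theorem s_one (γ : Vec3) : B.s γ 1 = B.ϱ (γ 2) * γ 1 := rfl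
theorem s_two (γ : Vec3) : B.s γ 2 = B.ζ (γ 2) := rfl

theorem contDiffAt_s {γ : Vec3} (hγ : γ 2 ∈ Set.Icc (-1 : ℝ) 1) : ContDiffAt ℝ ∞ B.s γ := by
  have c : ∀ i : Fin 3, ContDiffAt ℝ ∞ (fun γ : Vec3 => γ i) γ := fun i =>
    contDiffAt_pi.1 contDiffAt_id i
  have hr : ContDiffAt ℝ ∞ (fun γ : Vec3 => B.ϱ (γ 2)) γ :=
    ContDiffAt.comp γ (B.ϱ_smooth _ hγ) (c 2)
  have hζ : ContDiffAt ℝ ∞ (fun γ : Vec3 => B.ζ (γ 2)) γ :=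
    ContDiffAt.comp γ (B.ζ_smooth _ hγ) (c 2)
  refine contDiffAt_pi.2 fun i => ?_
  fin_cases i
  · exact hr.mul (c 0)
  · exact hr.mul (c 1)
  · exact hζ

theorem differentiableAt_s {γ : Vec3} (hγ : γ 2 ∈ Set.Icc (-1 : ℝ) 1) :
    DifferentiableAt ℝ B.s γ :=
  (B.contDiffAt_s hγ).differentiableAt (by simp)

theorem hasDerivAt_ϱ {z : ℝ} (hz : z ∈ Set.Icc (-1 : ℝ) 1) :
    HasDerivAt B.ϱ (deriv B.ϱ z) z :=
  ((B.ϱ_smooth z hz).differentiableAt (by simp)).hasDerivAt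

theorem hasDerivAt_ζ {z : ℝ} (hz : z ∈ Set.Icc (-1 : ℝ) 1) :
    HasDerivAt B.ζ (deriv B.ζ z) z :=
  ((B.ζ_smooth z hz).differentiableAt (by simp)).hasDerivAt

theorem fderiv_s {γ : Vec3} (hγ : γ 2 ∈ Set.Icc (-1 : ℝ) 1) (δ : Vec3) :
    fderiv ℝ B.s γ δ =
      ![B.ϱ (γ 2) * δ 0 + deriv B.ϱ (γ 2) * δ 2 * γ 0,
        B.ϱ (γ 2) * δ 1 + deriv B.ϱ (γ 2) * δ 2 * γ 1, deriv B.ζ (γ 2) * δ 2] := by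
  have hl := fun i => hasDerivAt_pi.1 (hasDerivAt_line γ δ) i
  refine HasDerivAt.fderiv_eq ?_ (B.differentiableAt_s hγ)
  have hr : HasDerivAt (fun t : ℝ => B.ϱ ((γ + t • δ) 2)) (deriv B.ϱ (γ 2) * δ 2) 0 :=
    HasDerivAt.comp_of_eq 0 (B.hasDerivAt_ϱ hγ) (hl 2) (by simp)
  have hζ : HasDerivAt (fun t : ℝ => B.ζ ((γ + t • δ) 2)) (deriv B.ζ (γ 2) * δ 2) 0 :=
    HasDerivAt.comp_of_eq 0 (B.hasDerivAt_ζ hγ) (hl 2) (by simp)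
  refine hasDerivAt_pi.2 fun i => ?_
  fin_cases i
  · refine (hr.mul (hl 0)).congr_deriv ?_
    simp; ring
  · refine (hr.mul (hl 1)).congr_deriv ?_
    simp; ring
  · exact hζ

theorem deriv_L {z : ℝ} (hz : z ∈ Set.Icc (-1 : ℝ) 1) :
    deriv B.L z = deriv B.ϱ z * z + B.ϱ z - deriv B.ζ z := by
  have := ((B.hasDerivAt_ϱ hz).fun_mul (hasDerivAt_id' z)).fun_sub (B.hasDerivAt_ζ hz)
  exact this.deriv.trans (by simp)

theorem contDiffAt_deriv {f : ℝ → ℝ} {z : ℝ} (hf : ContDiffAt ℝ ∞ f z) :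
    ContDiffAt ℝ ∞ (deriv f) z :=
  hf.derivWithin (by simp)

theorem normal_relation {z : ℝ} (hz : z ∈ Set.Icc (-1 : ℝ) 1) :
    deriv B.ϱ z * (1 - z ^ 2) = z * (B.ϱ z - deriv B.ζ z) := by
  have cont : ∀ f : ℝ → ℝ, (∀ z ∈ Set.Icc (-1 : ℝ) 1, ContDiffAt ℝ ∞ f z) →
      ContinuousOn (deriv f) (Set.Icc (-1) 1) := fun f hf z hz =>
    (contDiffAt_deriv (hf z hz)).continuousAt.continuousWithinAt
  have c1 := cont _ B.ϱ_smooth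
  have c2 := cont _ B.ζ_smooth
  have c3 : ContinuousOn B.ϱ (Set.Icc (-1) 1) := fun z hz =>
    (B.ϱ_smooth z hz).continuousAt.continuousWithinAt
  -- The normality condition only yields the relation multiplied by `1 - z²`. That factor is
  -- cancelled in the open interval, and continuity gives the poles.
  have hcl : Set.Icc (-1 : ℝ) 1 ⊆ closure (Set.Ioo (-1) 1) := by
    rw [closure_Ioo (by norm_num)]
  refine Set.EqOn.of_subset_closure (s := Set.Ioo (-1) 1)
    (f := fun z => deriv B.ϱ z * (1 - z ^ 2)) (g := fun z => z * (B.ϱ z - deriv B.ζ z))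
    (fun z hz => ?_) (by fun_prop) (by fun_prop) Set.Ioo_subset_Icc_self hcl hz
  have hk : 0 < 1 - z ^ 2 := by nlinarith [hz.1, hz.2]
  obtain ⟨r, hr⟩ : ∃ r, r = Real.sqrt (1 - z ^ 2) := ⟨_, rfl⟩
  have hr2 : r * r = 1 - z ^ 2 := by rw [hr]; exact Real.mul_self_sqrt hk.le
  -- Normality is tested at a point of a meridian; the tangent vector is `r` times the unit vector
  -- `(-z, 0, r)` along it.
  have h := B.normal ![r, 0, z] ![-z * r, 0, 1 - z ^ 2]
    (by simp; linear_combination hr2)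
    (by simp; linear_combination -z * hr2)
  have e := B.fderiv_s (γ := ![r, 0, z]) (by simpa using ⟨hz.1.le, hz.2.le⟩)
    ![-z * r, 0, 1 - z ^ 2]
  change fderiv ℝ (revolutionPoint B.ϱ B.ζ) _ _ = _ at e
  rw [e, Vec3.dot_eq] at h
  simp at h
  have : (1 - z ^ 2) * (deriv B.ϱ z * (1 - z ^ 2) - z * (B.ϱ z - deriv B.ζ z)) = 0 := by
    linear_combination h + (B.ϱ z * z - deriv B.ϱ z * (1 - z ^ 2)) * hr2
  linarith [(mul_eq_zero.1 this).resolve_left hk.ne']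

/-- Expressing both `ϱ'` and `ζ'` through `L'` makes every later identity polynomial, with no
division by `1 - z²`. -/
theorem deriv_ϱ_eq {z : ℝ} (hz : z ∈ Set.Icc (-1 : ℝ) 1) :
    deriv B.ϱ z = z * deriv B.L z := by
  rw [B.deriv_L hz]
  linear_combination B.normal_relation hz

theorem deriv_ζ_eq {z : ℝ} (hz : z ∈ Set.Icc (-1 : ℝ) 1) :
    deriv B.ζ z = B.ϱ z - (1 - z ^ 2) * deriv B.L z := by
  rw [B.deriv_L hz]
  linear_combination z * B.normal_relation hz

theorem dot_fderiv_s {γ u : Vec3} (hγ : γ ⬝ᵥ γ = 1) :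
    γ ⬝ᵥ fderiv ℝ B.s γ (γ ⨯₃ u) = 0 :=
  B.normal γ _ hγ (by simp)

theorem diagA_pos (γ : Vec3) (i : Fin 3) : 0 < B.diagA γ i := by
  have hm := B.m_pos
  have h1 := B.I₁_pos
  have h3 := B.I₃_pos
  have hN : 0 ≤ B.s γ ⬝ᵥ B.s γ := by
    rw [Vec3.dot_eq]
    nlinarith [mul_self_nonneg (B.s γ 0), mul_self_nonneg (B.s γ 1), mul_self_nonneg (B.s γ 2)]
  fin_cases i <;> simp [diagA] <;> positivity

/-- Multiplied by `diagA γ 0 * diagA γ 2`, the denominator becomes `I₁ I₃ + m ⟨𝕀 s, s⟩`, a positive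
number. -/
theorem angVel_denominator_ne_zero (γ : Vec3) :
    1 - B.m * ((fun i => B.s γ i / B.diagA γ i : Vec3) ⬝ᵥ B.s γ) ≠ 0 := by
  have hm := B.m_pos
  have h1 := B.I₁_pos
  have h3 := B.I₃_pos
  obtain ⟨x, hx⟩ : ∃ x, x = B.s γ 0 := ⟨_, rfl⟩
  obtain ⟨y, hy⟩ : ∃ y, y = B.s γ 1 := ⟨_, rfl⟩
  obtain ⟨z, hz⟩ : ∃ z, z = B.s γ 2 := ⟨_, rfl⟩
  obtain ⟨a, ha⟩ : ∃ a, a = B.I₁ + B.m * (x * x + y * y + z * z) := ⟨_, rfl⟩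
  obtain ⟨c, hc⟩ : ∃ c, c = B.I₃ + B.m * (x * x + y * y + z * z) := ⟨_, rfl⟩
  have A0 : B.diagA γ 0 = a := by simp [diagA, Vec3.dot_eq, ha, hx, hy, hz]
  have A1 : B.diagA γ 1 = a := by simp [diagA, Vec3.dot_eq, ha, hx, hy, hz]
  have A2 : B.diagA γ 2 = c := by simp [diagA, Vec3.dot_eq, hc, hx, hy, hz]
  have ha0 : 0 < a := by rw [← A0]; exact B.diagA_pos γ 0
  have hc0 : 0 < c := by rw [← A2]; exact B.diagA_pos γ 2
  rw [Vec3.dot_eq, A0, A1, A2, ← hx, ← hy, ← hz]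
  intro h
  have e : (1 - B.m * (x / a * x + y / a * y + z / c * z)) * (a * c)
      = B.I₁ * B.I₃ + B.m * B.I₁ * (x * x + y * y) + B.m * B.I₃ * (z * z) := by
    field_simp
    rw [ha, hc]
    ring
  rw [h, zero_mul] at e
  have hxy : 0 ≤ x * x + y * y := add_nonneg (mul_self_nonneg x) (mul_self_nonneg y)
  have hzz : 0 ≤ z * z := mul_self_nonneg z
  have : 0 < B.I₁ * B.I₃ + B.m * B.I₁ * (x * x + y * y) + B.m * B.I₃ * (z * z) := by positivity
  linarith

theorem differentiableAt_Ω {p : Phase} (hp : p.1.1 2 2 ∈ Set.Icc (-1 : ℝ) 1) :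
    DifferentiableAt ℝ B.Ω p := by
  have hγ : DifferentiableAt ℝ (fun p : Phase => p.1.1 2) p := by fun_prop
  have hs : DifferentiableAt ℝ (fun p : Phase => B.s (p.1.1 2)) p :=
    DifferentiableAt.comp p (B.differentiableAt_s hp) hγ
  have hss := hs.dotVec3 hs
  have hA : ∀ i, DifferentiableAt ℝ (fun p : Phase => B.diagA (p.1.1 2) i) p := by
    intro i
    fin_cases i <;> simp [diagA] <;> exact (hss.const_mul _)
  have hA0 : ∀ i, B.diagA (p.1.1 2) i ≠ 0 := fun i => (B.diagA_pos _ i).ne'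
  have hM : DifferentiableAt ℝ (fun p : Phase => p.2) p := by fun_prop
  have hu : DifferentiableAt ℝ (fun p : Phase => (fun i => p.2 i / B.diagA (p.1.1 2) i : Vec3)) p :=
    differentiableAt_pi.2 fun i => (differentiableAt_pi.1 hM i).divReal (hA i) (hA0 i)
  have hw : DifferentiableAt ℝ (fun p : Phase =>
      (fun i => B.s (p.1.1 2) i / B.diagA (p.1.1 2) i : Vec3)) p :=
    differentiableAt_pi.2 fun i => (differentiableAt_pi.1 hs i).divReal (hA i) (hA0 i)
  exact hu.add ((((hu.dotVec3 hs).divReal (((hw.dotVec3 hs).const_mul _).const_sub 1)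
    (B.angVel_denominator_ne_zero _)).const_mul B.m).smul hw)

end RollingBody

theorem DifferentiableAt.rowsMul {E : Type*} [NormedAddCommGroup E] [NormedSpace ℝ E]
    {g : E → Fin 3 → Vec3} {A : E → Vec3} {x : E} (hg : DifferentiableAt ℝ g x)
    (hA : DifferentiableAt ℝ A x) : DifferentiableAt ℝ (fun y => rowsMul (g y) (A y)) x :=
  differentiableAt_pi.2 fun i => (differentiableAt_pi.1 hg i).dotVec3 hA

theorem HasDerivAt.rowsMul {g : ℝ → Fin 3 → Vec3} {A : ℝ → Vec3} {g' : Fin 3 → Vec3} {A' : Vec3}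
    {t : ℝ} (hg : HasDerivAt g g' t) (hA : HasDerivAt A A' t) :
    HasDerivAt (fun y => rowsMul (g y) (A y)) (rowsMul g' (A t) + rowsMul (g t) A') t :=
  hasDerivAt_pi.2 fun i => (hasDerivAt_pi.1 hg i).dotVec3 hA

theorem DifferentiableAt.mcForm {E : Type*} [NormedAddCommGroup E] [NormedSpace ℝ E]
    {g : E → Fin 3 → Vec3} {x : E} (hg : DifferentiableAt ℝ g x) (δ : Fin 3 → Vec3) :
    DifferentiableAt ℝ (fun y => mcForm (g y) δ) x := by
  have h := fun i => (differentiableAt_pi.1 hg i).crossVec3 (differentiableAt_const (δ i))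
  simp only [mcForm_coord]
  exact (((h 0).add (h 1)).add (h 2)).const_smul (-(1 / 2 : ℝ))

theorem HasDerivAt.mcForm {g : ℝ → Fin 3 → Vec3} {g' : Fin 3 → Vec3} {t : ℝ}
    (hg : HasDerivAt g g' t) (δ : Fin 3 → Vec3) :
    HasDerivAt (fun y => mcForm (g y) δ) (mcForm g' δ) t := by
  have h := fun i => (hasDerivAt_pi.1 hg i).crossVec3 (hasDerivAt_const t (δ i))
  simp only [mcForm_coord]
  refine (((h 0).add (h 1)).add (h 2)).const_smul (-(1 / 2 : ℝ)) |>.congr_deriv ?_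
  simp

/-! ### The two-form on `𝓒` and the nonholonomic vector field. -/

namespace RollingBody

variable (B : RollingBody)

theorem inertia_zero (u : Vec3) : B.inertia u 0 = B.I₁ * u 0 := rfl
theorem inertia_one (u : Vec3) : B.inertia u 1 = B.I₁ * u 1 := rfl
theorem inertia_two (u : Vec3) : B.inertia u 2 = B.I₃ * u 2 := rfl

theorem differentiableAt_inertia {E : Type*} [NormedAddCommGroup E] [NormedSpace ℝ E]
    {A : E → Vec3} {x : E} (hA : DifferentiableAt ℝ A x) :
    DifferentiableAt ℝ (fun y => B.inertia (A y)) x := by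
  have a := differentiableAt_pi.1 hA
  refine differentiableAt_pi.2 fun i => ?_
  fin_cases i
  exacts [(a 0).const_mul _, (a 1).const_mul _, (a 2).const_mul _]

theorem hasDerivAt_inertia {A : ℝ → Vec3} {A' : Vec3} {t : ℝ} (hA : HasDerivAt A A' t) :
    HasDerivAt (fun y => B.inertia (A y)) (B.inertia A') t := by
  have a := hasDerivAt_pi.1 hA
  refine hasDerivAt_pi.2 fun i => ?_
  fin_cases i
  exacts [(a 0).const_mul _, (a 1).const_mul _, (a 2).const_mul _]

/-- The vector of `𝓒` with angular velocity `u` and momentum component `N`. -/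
def constrainedVec (p : Phase) (u N : Vec3) : Phase :=
  ((fun i => p.1.1 i ⨯₃ u, -rowsMul p.1.1 (u ⨯₃ B.s (p.1.1 2))), N)

theorem constrainedVec_mem (p : Phase) (u N : Vec3) : B.constrainedVec p u N ∈ B.C p :=
  ⟨u, rfl⟩

theorem exists_of_mem_C {p v : Phase} (hv : v ∈ B.C p) :
    ∃ u N, v = B.constrainedVec p u N := by
  obtain ⟨u, hu⟩ := hv
  exact ⟨u, v.2, Prod.ext hu rfl⟩

theorem isRot_of_mem {p : Phase} (hp : p ∈ B.phase) : IsRot p.1.1 := hp.1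

theorem third_mem {p : Phase} (hp : p ∈ B.phase) : p.1.1 2 2 ∈ Set.Icc (-1 : ℝ) 1 :=
  (B.isRot_of_mem hp).third_mem_Icc

theorem differentiableAt_contact {p : Phase} (hp : p ∈ B.phase) :
    DifferentiableAt ℝ (fun p : Phase => B.s (p.1.1 2)) p :=
  DifferentiableAt.comp p (B.differentiableAt_s (B.third_mem hp)) (by fun_prop)

theorem differentiableAt_centreVel {p : Phase} (hp : p ∈ B.phase) :
    DifferentiableAt ℝ B.centreVel p :=
  (DifferentiableAt.rowsMul (g := fun p : Phase => p.1.1) (by fun_prop)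
    ((B.differentiableAt_Ω (B.third_mem hp)).crossVec3 (B.differentiableAt_contact hp))).neg

theorem differentiableAt_liouville {p : Phase} (hp : p ∈ B.phase) (w : Phase) :
    DifferentiableAt ℝ (fun p' => B.liouville p' w) p :=
  ((B.differentiableAt_inertia (B.differentiableAt_Ω (B.third_mem hp))).dotVec3
    (DifferentiableAt.mcForm (g := fun p : Phase => p.1.1) (by fun_prop) _)).add
    (((B.differentiableAt_centreVel hp).dotVec3 (differentiableAt_const _)).const_mul _)

theorem differentiableAt_hamiltonian {p : Phase} (hp : p ∈ B.phase) :
    DifferentiableAt ℝ B.hamiltonian p := by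
  have h1 := B.differentiableAt_Ω (B.third_mem hp)
  have h2 := B.differentiableAt_centreVel hp
  exact ((((B.differentiableAt_inertia h1).dotVec3 h1).const_mul _).add
    ((h2.dotVec3 h2).const_mul _)).add (DifferentiableAt.const_mul (by fun_prop) _)

theorem differentiableAt_constraintForm {p : Phase} (hp : p ∈ B.phase) (i : Fin 3) (w : Phase) :
    DifferentiableAt ℝ (fun p' => B.constraintForm i p' w) p :=
  (differentiableAt_const _).add (differentiableAt_pi.1
    (DifferentiableAt.rowsMul (g := fun p : Phase => p.1.1) (by fun_prop)
      ((DifferentiableAt.mcForm (g := fun p : Phase => p.1.1) (by fun_prop) _).crossVec3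
        (B.differentiableAt_contact hp))) i)

theorem hasDerivAt_frame (p : Phase) (u N : Vec3) :
    HasDerivAt (fun t : ℝ => (p + t • B.constrainedVec p u N).1.1) (fun i => p.1.1 i ⨯₃ u) 0 :=
  hasDerivAt_line p.1.1 (fun i => p.1.1 i ⨯₃ u)

theorem hasDerivAt_contact {p : Phase} (hp : p ∈ B.phase) (u N : Vec3) :
    HasDerivAt (fun t : ℝ => B.s ((p + t • B.constrainedVec p u N).1.1 2))
      (fderiv ℝ B.s (p.1.1 2) (p.1.1 2 ⨯₃ u)) 0 :=
  (B.differentiableAt_s (B.third_mem hp)).hasDerivAt_line (p.1.1 2 ⨯₃ u)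

theorem hasDerivAt_Ω {p : Phase} (hp : p ∈ B.phase) (v : Phase) :
    HasDerivAt (fun t : ℝ => B.Ω (p + t • v)) (fderiv ℝ B.Ω p v) 0 :=
  (B.differentiableAt_Ω (B.third_mem hp)).hasDerivAt_line v

theorem hasDerivAt_centreVel {p : Phase} (hp : p ∈ B.phase) (u N : Vec3) :
    HasDerivAt (fun t : ℝ => B.centreVel (p + t • B.constrainedVec p u N))
      (-rowsMul p.1.1 (u ⨯₃ (B.Ω p ⨯₃ B.s (p.1.1 2)) +
        (fderiv ℝ B.Ω p (B.constrainedVec p u N) ⨯₃ B.s (p.1.1 2) +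
          B.Ω p ⨯₃ fderiv ℝ B.s (p.1.1 2) (p.1.1 2 ⨯₃ u)))) 0 := by
  have h := ((B.hasDerivAt_frame p u N).rowsMul
    ((B.hasDerivAt_Ω hp (B.constrainedVec p u N)).crossVec3 (B.hasDerivAt_contact hp u N))).neg
  refine h.congr_deriv ?_
  simp only [zero_smul, add_zero, rowsMul_cross, rowsMul_add]

/-- The differentiated relation `M = 𝕀 Ω + m s × (Ω × s)`. -/
theorem momentum_derivative {p : Phase} (hp : p ∈ B.phase) (u N : Vec3) :
    B.inertia (fderiv ℝ B.Ω p (B.constrainedVec p u N)) +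
      B.m • (fderiv ℝ B.s (p.1.1 2) (p.1.1 2 ⨯₃ u) ⨯₃ (B.Ω p ⨯₃ B.s (p.1.1 2)) +
        B.s (p.1.1 2) ⨯₃ (fderiv ℝ B.Ω p (B.constrainedVec p u N) ⨯₃ B.s (p.1.1 2) +
          B.Ω p ⨯₃ fderiv ℝ B.s (p.1.1 2) (p.1.1 2 ⨯₃ u))) = N := by
  have hs := B.hasDerivAt_contact hp u N
  have hΩ := B.hasDerivAt_Ω hp (B.constrainedVec p u N)
  have h := (B.hasDerivAt_inertia hΩ).add ((hs.crossVec3 (hΩ.crossVec3 hs)).const_smul B.m)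
  have h2 : HasDerivAt (fun t : ℝ => (p + t • B.constrainedVec p u N).2) N 0 :=
    hasDerivAt_line p.2 N
  have e := h.unique (h2.congr_of_eventuallyEq (Filter.Eventually.of_forall fun t =>
    B.momentum_angVel _ _))
  simpa only [zero_smul, add_zero] using e

theorem fderiv_liouville {p : Phase} (hp : p ∈ B.phase) (u N u' N' : Vec3) :
    fderiv ℝ (fun p' => B.liouville p' (B.constrainedVec p u' N')) p (B.constrainedVec p u N) =
      B.inertia (fderiv ℝ B.Ω p (B.constrainedVec p u N)) ⬝ᵥ u' +
      B.inertia (B.Ω p) ⬝ᵥ (-(1 / 2 : ℝ) • (u ⨯₃ u')) +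
      B.m * ((u ⨯₃ (B.Ω p ⨯₃ B.s (p.1.1 2)) +
        (fderiv ℝ B.Ω p (B.constrainedVec p u N) ⨯₃ B.s (p.1.1 2) +
          B.Ω p ⨯₃ fderiv ℝ B.s (p.1.1 2) (p.1.1 2 ⨯₃ u))) ⬝ᵥ (u' ⨯₃ B.s (p.1.1 2))) := by
  have hg := B.isRot_of_mem hp
  refine HasDerivAt.fderiv_eq ?_ (B.differentiableAt_liouville hp _)
  have hΩ := B.hasDerivAt_Ω hp (B.constrainedVec p u N)
  have h := ((B.hasDerivAt_inertia hΩ).dotVec3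
    ((B.hasDerivAt_frame p u N).mcForm (fun i => p.1.1 i ⨯₃ u'))).add
    (((B.hasDerivAt_centreVel hp u N).dotVec3 (hasDerivAt_const 0
      (-rowsMul p.1.1 (u' ⨯₃ B.s (p.1.1 2))))).const_mul B.m)
  refine h.congr_deriv ?_
  simp only [zero_smul, add_zero, hg.mcForm_cross, hg.mcForm_cross_cross, dotProduct_zero,
    neg_dotProduct_neg, hg.rowsMul_dot]

/-- The derivatives of `Ω` enter only in the combinations that `momentum_derivative` identifies with
`N` and `N'`, so neither has to be computed. -/
theorem symplectic_constrained {p : Phase} (hp : p ∈ B.phase) (u N u' N' : Vec3) :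
    B.symplectic p (B.constrainedVec p u N) (B.constrainedVec p u' N') =
      u ⬝ᵥ N' - u' ⬝ᵥ N - B.inertia (B.Ω p) ⬝ᵥ (u' ⨯₃ u) +
      B.m * (u' ⬝ᵥ (fderiv ℝ B.s (p.1.1 2) (p.1.1 2 ⨯₃ u) ⨯₃ (B.Ω p ⨯₃ B.s (p.1.1 2))) -
        u ⬝ᵥ (fderiv ℝ B.s (p.1.1 2) (p.1.1 2 ⨯₃ u') ⨯₃ (B.Ω p ⨯₃ B.s (p.1.1 2))) -
        (u ⨯₃ (B.Ω p ⨯₃ B.s (p.1.1 2))) ⬝ᵥ (u' ⨯₃ B.s (p.1.1 2)) +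
        (u' ⨯₃ (B.Ω p ⨯₃ B.s (p.1.1 2))) ⬝ᵥ (u ⨯₃ B.s (p.1.1 2))) := by
  have e := B.momentum_derivative hp u N
  have e' := B.momentum_derivative hp u' N'
  unfold symplectic dOneForm
  rw [B.fderiv_liouville hp, B.fderiv_liouville hp]
  generalize fderiv ℝ B.Ω p (B.constrainedVec p u N) = W at *
  generalize fderiv ℝ B.Ω p (B.constrainedVec p u' N') = W' at *
  generalize fderiv ℝ B.s (p.1.1 2) (p.1.1 2 ⨯₃ u) = S at *
  generalize fderiv ℝ B.s (p.1.1 2) (p.1.1 2 ⨯₃ u') = S' at *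
  generalize B.Ω p = w at *
  generalize B.s (p.1.1 2) = s at *
  -- Substituting for `N` and `N'`, rather than solving for the derivatives `W, W'` of `Ω`, leaves a
  -- polynomial identity.
  subst e e'
  simp only [Vec3.dot_eq, Vec3.cross_zero, Vec3.cross_one, Vec3.cross_two, Pi.add_apply,
    Pi.smul_apply, smul_eq_mul, inertia_zero, inertia_one, inertia_two]
  ring

theorem fderiv_hamiltonian {p : Phase} (hp : p ∈ B.phase) (u N : Vec3) :
    fderiv ℝ B.hamiltonian p (B.constrainedVec p u N) =
      B.Ω p ⬝ᵥ N - B.m * (B.Ω p ⬝ᵥ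
        (fderiv ℝ B.s (p.1.1 2) (p.1.1 2 ⨯₃ u) ⨯₃ (B.Ω p ⨯₃ B.s (p.1.1 2)))) -
      B.m * B.grav * (p.1.1 2 ⬝ᵥ (u ⨯₃ B.s (p.1.1 2))) := by
  have hg := B.isRot_of_mem hp
  have e := B.momentum_derivative hp u N
  have hΩ := B.hasDerivAt_Ω hp (B.constrainedVec p u N)
  have hc := B.hasDerivAt_centreVel hp u N
  have ha : HasDerivAt (fun t : ℝ => (p + t • B.constrainedVec p u N).1.2 2)
      (-(p.1.1 2 ⬝ᵥ (u ⨯₃ B.s (p.1.1 2)))) 0 :=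
    hasDerivAt_pi.1 (hasDerivAt_line p.1.2 (-rowsMul p.1.1 (u ⨯₃ B.s (p.1.1 2)))) 2
  have h := ((((B.hasDerivAt_inertia hΩ).dotVec3 hΩ).const_mul (1 / 2 : ℝ)).add
    ((hc.dotVec3 hc).const_mul (1 / 2 * B.m))).add (ha.const_mul (B.m * B.grav))
  rw [HasDerivAt.fderiv_eq h (B.differentiableAt_hamiltonian hp)]
  simp only [zero_smul, add_zero, centreVel, neg_dotProduct_neg, hg.rowsMul_dot]
  generalize fderiv ℝ B.Ω p (B.constrainedVec p u N) = W at *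
  generalize fderiv ℝ B.s (p.1.1 2) (p.1.1 2 ⨯₃ u) = S at *
  generalize B.Ω p = w at *
  generalize B.s (p.1.1 2) = s at *
  subst e
  simp only [Vec3.dot_eq, Vec3.cross_zero, Vec3.cross_one, Vec3.cross_two, Pi.add_apply,
    Pi.smul_apply, smul_eq_mul, inertia_zero, inertia_one, inertia_two]
  ring

/-- The rate of change of `M` along the nonholonomic vector field. -/
noncomputable def momentumRate (p : Phase) : Vec3 :=
  B.m • (fderiv ℝ B.s (p.1.1 2) (p.1.1 2 ⨯₃ B.Ω p) ⨯₃ (B.Ω p ⨯₃ B.s (p.1.1 2))) -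
    B.m • (B.s (p.1.1 2) ⨯₃ (B.Ω p ⨯₃ (B.Ω p ⨯₃ B.s (p.1.1 2)))) -
    B.Ω p ⨯₃ B.inertia (B.Ω p) + (B.m * B.grav) • (B.s (p.1.1 2) ⨯₃ p.1.1 2)

theorem eq_of_forall_dot {a b : Vec3} (h : ∀ u : Vec3, u ⬝ᵥ a = u ⬝ᵥ b) : a = b := by
  ext i
  simpa using h (Pi.single i 1)

/-- For `u = Ω` all terms in `N'` and in the variation of `s` along `u'` cancel. The remainder is
linear in `u'`, and `momentumRate` is read off from it. -/
theorem symplectic_sub_fderiv_hamiltonian {p : Phase} (hp : p ∈ B.phase) (N u' N' : Vec3) :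
    B.symplectic p (B.constrainedVec p (B.Ω p) N) (B.constrainedVec p u' N') -
      fderiv ℝ B.hamiltonian p (B.constrainedVec p u' N') =
      u' ⬝ᵥ B.momentumRate p - u' ⬝ᵥ N := by
  rw [B.symplectic_constrained hp, B.fderiv_hamiltonian hp]
  unfold momentumRate
  generalize fderiv ℝ B.s (p.1.1 2) (p.1.1 2 ⨯₃ B.Ω p) = S at *
  generalize fderiv ℝ B.s (p.1.1 2) (p.1.1 2 ⨯₃ u') = S' at *
  generalize B.Ω p = w at *
  generalize B.s (p.1.1 2) = s at *
  simp only [Vec3.dot_eq, Vec3.cross_zero, Vec3.cross_one, Vec3.cross_two, Pi.add_apply,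
    Pi.smul_apply, Pi.sub_apply, smul_eq_mul, inertia_zero, inertia_one, inertia_two]
  ring

theorem isNonholonomicVector_iff {p : Phase} (hp : p ∈ B.phase) (v : Phase) :
    B.IsNonholonomicVector p v ↔ v = B.constrainedVec p (B.Ω p) (B.momentumRate p) := by
  constructor
  · rintro ⟨hv, h⟩
    obtain ⟨u, N, rfl⟩ := B.exists_of_mem_C hv
    have hu : u = B.Ω p := by
      refine eq_of_forall_dot fun N' => ?_
      -- Vertical test vectors see only the canonical pairing, hence give `u = Ω`; those with `N' =
      -- 0` then determine `N`.
      have := h _ (B.constrainedVec_mem p 0 N')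
      rw [B.symplectic_constrained hp, B.fderiv_hamiltonian hp] at this
      simpa [dotProduct_comm] using this
    subst hu
    have hN : N = B.momentumRate p := by
      refine eq_of_forall_dot fun u' => ?_
      have := B.symplectic_sub_fderiv_hamiltonian hp N u' 0
      rw [h _ (B.constrainedVec_mem p u' 0)] at this
      linarith
    rw [hN]
  · rintro rfl
    refine ⟨B.constrainedVec_mem _ _ _, fun w hw => ?_⟩
    obtain ⟨u', N', rfl⟩ := B.exists_of_mem_C hw
    have := B.symplectic_sub_fderiv_hamiltonian hp (B.momentumRate p) u' N'
    linarith

theorem existsUnique_nonholonomicVector {p : Phase} (hp : p ∈ B.phase) :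
    ∃! v : Phase, B.IsNonholonomicVector p v :=
  ⟨_, (B.isNonholonomicVector_iff hp _).2 rfl, fun v hv => (B.isNonholonomicVector_iff hp v).1 hv⟩

theorem Xnh_eq {p : Phase} (hp : p ∈ B.phase) :
    B.Xnh p = B.constrainedVec p (B.Ω p) (B.momentumRate p) :=
  (B.isNonholonomicVector_iff hp _).1
    (Classical.epsilon_spec (B.existsUnique_nonholonomicVector hp).exists)

/-! ### The curvature term and the functions `𝒬`, `𝒫`. -/

theorem fderiv_constraintForm {p : Phase} (hp : p ∈ B.phase) (i : Fin 3) (u N u' N' : Vec3) :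
    fderiv ℝ (fun p' => B.constraintForm i p' (B.constrainedVec p u' N')) p
      (B.constrainedVec p u N) =
      p.1.1 i ⬝ᵥ (u ⨯₃ (u' ⨯₃ B.s (p.1.1 2)) +
        ((-(1 / 2 : ℝ) • (u ⨯₃ u')) ⨯₃ B.s (p.1.1 2) +
          u' ⨯₃ fderiv ℝ B.s (p.1.1 2) (p.1.1 2 ⨯₃ u))) := by
  have hg := B.isRot_of_mem hp
  refine HasDerivAt.fderiv_eq ?_ (B.differentiableAt_constraintForm hp i _)
  have h := (hasDerivAt_pi.1 ((B.hasDerivAt_frame p u N).rowsMul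
    (((B.hasDerivAt_frame p u N).mcForm (fun i => p.1.1 i ⨯₃ u')).crossVec3
      (B.hasDerivAt_contact hp u N))) i).const_add ((-rowsMul p.1.1 (u' ⨯₃ B.s (p.1.1 2))) i)
  refine h.congr_deriv ?_
  simp only [zero_smul, add_zero, hg.mcForm_cross, hg.mcForm_cross_cross, rowsMul_cross,
    ← rowsMul_add]
  rfl

/-- By the Jacobi identity the double products `u × (u' × s)` cancel against the variation of `λ`;
only the variation of `s` survives. -/
theorem dOneForm_constraintForm {p : Phase} (hp : p ∈ B.phase) (i : Fin 3) (u N u' N' : Vec3) :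
    dOneForm (B.constraintForm i) p (B.constrainedVec p u N) (B.constrainedVec p u' N') =
      p.1.1 i ⬝ᵥ (u' ⨯₃ fderiv ℝ B.s (p.1.1 2) (p.1.1 2 ⨯₃ u) -
        u ⨯₃ fderiv ℝ B.s (p.1.1 2) (p.1.1 2 ⨯₃ u')) := by
  unfold dOneForm
  rw [B.fderiv_constraintForm hp, B.fderiv_constraintForm hp]
  simp only [Vec3.dot_eq, Vec3.cross_zero, Vec3.cross_one, Vec3.cross_two, Pi.add_apply,
    Pi.smul_apply, Pi.sub_apply, smul_eq_mul]
  ring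

theorem liouville_translation (p : Phase) (i : Fin 3) :
    B.liouville p ((0, Pi.single i 1), 0) = B.m * B.centreVel p i := by
  simp [liouville, mcForm_zero]

theorem fderiv_s_cross {γ : Vec3} (hγ : γ 2 ∈ Set.Icc (-1 : ℝ) 1) (u : Vec3) :
    fderiv ℝ B.s γ (γ ⨯₃ u) =
      ![B.ϱ (γ 2) * (γ 1 * u 2 - γ 2 * u 1) +
          deriv B.L (γ 2) * (γ 0 * u 1 - γ 1 * u 0) * (γ 2 * γ 0),
        B.ϱ (γ 2) * (γ 2 * u 0 - γ 0 * u 2) +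
          deriv B.L (γ 2) * (γ 0 * u 1 - γ 1 * u 0) * (γ 2 * γ 1),
        (B.ϱ (γ 2) - (1 - γ 2 ^ 2) * deriv B.L (γ 2)) * (γ 0 * u 1 - γ 1 * u 0)] := by
  rw [B.fderiv_s hγ, B.deriv_ϱ_eq hγ, B.deriv_ζ_eq hγ, Vec3.cross_zero, Vec3.cross_one,
    Vec3.cross_two]
  apply Vec3.ext_coord <;> simp <;> ring

/-- Put `d = u' × u`, `h = e₃ × γ` and `n = γ₃ γ - e₃`, so that `δs = ϱ δγ + L' ⟨h, u⟩ n`. The first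
part gives `γ × d` by Jacobi. The second gives `(h × d) × n = -⟨d, n⟩ h`, because `h` is orthogonal
to `n`. -/
theorem cross_fderiv_s_sub {γ : Vec3} (hγ : γ 2 ∈ Set.Icc (-1 : ℝ) 1) (u u' : Vec3) :
    u' ⨯₃ fderiv ℝ B.s γ (γ ⨯₃ u) - u ⨯₃ fderiv ℝ B.s γ (γ ⨯₃ u') =
      B.ϱ (γ 2) • (γ ⨯₃ (u' ⨯₃ u)) -
        (deriv B.L (γ 2) * (γ 2 * (γ ⬝ᵥ (u' ⨯₃ u)) - (u' ⨯₃ u) 2)) • ![-γ 1, γ 0, 0] := by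
  rw [B.fderiv_s_cross hγ, B.fderiv_s_cross hγ]
  apply Vec3.ext_coord <;>
    simp [Vec3.dot_eq, Vec3.cross_zero, Vec3.cross_one, Vec3.cross_two] <;> ring

theorem JK_constrained {p : Phase} (hp : p ∈ B.phase) (u N u' N' : Vec3) :
    B.JK p (B.constrainedVec p u N) (B.constrainedVec p u' N') =
      -(B.m * ((B.Ω p ⨯₃ B.s (p.1.1 2)) ⬝ᵥ
        (B.ϱ (p.1.1 2 2) • (p.1.1 2 ⨯₃ (u' ⨯₃ u)) -
          (deriv B.L (p.1.1 2 2) * (p.1.1 2 2 * (p.1.1 2 ⬝ᵥ (u' ⨯₃ u)) - (u' ⨯₃ u) 2)) •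
            ![-p.1.1 2 1, p.1.1 2 0, 0]))) := by
  have hg := B.isRot_of_mem hp
  unfold JK
  rw [Finset.sum_pair (by decide)]
  simp only [B.liouville_translation, B.dOneForm_constraintForm hp]
  rw [B.cross_fderiv_s_sub (B.third_mem hp)]
  -- The third row of the frame is `γ`, which is orthogonal to `b`, so the two horizontal
  -- translations already produce the full inner product.
  have key : ∀ a b : Vec3, p.1.1 2 ⬝ᵥ b = 0 →
      B.m * (-rowsMul p.1.1 a) 0 * (p.1.1 0 ⬝ᵥ b) + B.m * (-rowsMul p.1.1 a) 1 * (p.1.1 1 ⬝ᵥ b) =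
        -(B.m * (a ⬝ᵥ b)) := by
    intro a b hb
    have h := hg.rowsMul_dot a b
    rw [Vec3.dot_eq] at h
    simp only [rowsMul] at h
    simp only [Pi.neg_apply, rowsMul]
    rw [hb] at h
    linear_combination -B.m * h
  refine key _ _ ?_
  simp only [Vec3.dot_eq, Vec3.cross_zero, Vec3.cross_one, Vec3.cross_two, Pi.sub_apply,
    Pi.smul_apply, smul_eq_mul, Matrix.cons_val]
  ring

theorem P_pos {z : ℝ} (hz : z ∈ Set.Icc (-1 : ℝ) 1) : 0 < B.P z := by
  have hm := B.m_pos
  have h1 := B.I₁_pos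
  have h3 := B.I₃_pos
  have hk : 0 ≤ 1 - z ^ 2 := by nlinarith [hz.1, hz.2]
  unfold P
  positivity

theorem momentum_coord (p : Phase) (i : Fin 3) :
    p.2 i = B.inertia (B.Ω p) i + B.m * (B.s (p.1.1 2) ⨯₃ (B.Ω p ⨯₃ B.s (p.1.1 2))) i := by
  conv_lhs => rw [← B.momentum_angVel (p.1.1 2) p.2]
  rfl

theorem third_sq {p : Phase} (hp : p ∈ B.phase) :
    p.1.1 2 0 * p.1.1 2 0 + p.1.1 2 1 * p.1.1 2 1 = 1 - p.1.1 2 2 ^ 2 := by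
  have := (B.isRot_of_mem hp).third_dot_self
  rw [Vec3.dot_eq] at this
  linear_combination this

/-- `τ₃` and `τ₄` in terms of the angular velocity. -/
theorem tau_eq {p : Phase} (hp : p ∈ B.phase) :
    p.1.1 2 0 * p.2 0 + p.1.1 2 1 * p.2 1 =
      (B.I₁ + B.m * B.ζ (p.1.1 2 2) ^ 2) * (p.1.1 2 0 * B.Ω p 0 + p.1.1 2 1 * B.Ω p 1) -
        B.m * B.ζ (p.1.1 2 2) * B.ϱ (p.1.1 2 2) * (1 - p.1.1 2 2 ^ 2) * B.Ω p 2 ∧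
    p.2 2 = (B.I₃ + B.m * B.ϱ (p.1.1 2 2) ^ 2 * (1 - p.1.1 2 2 ^ 2)) * B.Ω p 2 -
        B.m * B.ζ (p.1.1 2 2) * B.ϱ (p.1.1 2 2) *
          (p.1.1 2 0 * B.Ω p 0 + p.1.1 2 1 * B.Ω p 1) := by
  have hk := B.third_sq hp
  rw [B.momentum_coord p 0, B.momentum_coord p 1, B.momentum_coord p 2]
  simp only [inertia_zero, inertia_one, inertia_two, Vec3.cross_zero, Vec3.cross_one,
    Vec3.cross_two, s_zero, s_one, s_two]
  constructor
  · linear_combination (-(B.m * B.ζ (p.1.1 2 2) * B.ϱ (p.1.1 2 2) * B.Ω p 2)) * hk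
  · linear_combination (B.m * B.ϱ (p.1.1 2 2) ^ 2 * B.Ω p 2) * hk

theorem qpVec_apply (p : Phase) (i : Fin 2) :
    B.qpVec p i = B.QP (p.1.1 2 2) i 0 * (p.1.1 2 0 * p.2 0 + p.1.1 2 1 * p.2 1) +
      B.QP (p.1.1 2 2) i 1 * p.2 2 := by
  simp [qpVec, Matrix.mulVec, dotProduct, Fin.sum_univ_two]

theorem QP_zero_zero (z : ℝ) : B.QP z 0 0 = B.m / B.P z *
    (B.I₃ * (-B.ϱ z ^ 2 - deriv B.ϱ z * B.ζ z) - B.ϱ z ^ 3 * B.σ z) := by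
  simp [QP]

theorem QP_zero_one (z : ℝ) : B.QP z 0 1 = B.m / B.P z *
    (-B.ϱ z * B.I₁ * (B.ϱ z * z - deriv B.ϱ z * (1 - z ^ 2)) - B.ϱ z ^ 2 * B.ζ z * B.σ z) := by
  simp [QP]

theorem QP_one_zero (z : ℝ) : B.QP z 1 0 = B.m / B.P z *
    (B.I₃ * (B.ϱ z * B.L z + deriv B.L z * B.ζ z) + B.ϱ z ^ 2 * B.L z * B.σ z) := by
  simp [QP]

theorem QP_one_one (z : ℝ) : B.QP z 1 1 = B.m / B.P z *
    (B.ϱ z * B.I₁ * (B.L z * z - deriv B.L z * (1 - z ^ 2)) +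
      B.ϱ z * B.ζ z * B.L z * B.σ z) := by
  simp [QP]

/-- The linear map in `tau_eq` from `(γ₁ Ω₁ + γ₂ Ω₂, Ω₃)` to `(τ₃, τ₄)` has determinant `P`. This is
where the denominator of `[𝒬𝒫]` comes from and why it disappears in terms of `Ω`. -/
theorem qpVec_zero {p : Phase} (hp : p ∈ B.phase) :
    B.qpVec p 0 = -(B.m * ((B.ϱ (p.1.1 2 2) ^ 2 +
        p.1.1 2 2 * deriv B.L (p.1.1 2 2) * B.ζ (p.1.1 2 2)) *
          (p.1.1 2 0 * B.Ω p 0 + p.1.1 2 1 * B.Ω p 1) +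
      B.ϱ (p.1.1 2 2) * p.1.1 2 2 *
        (B.ϱ (p.1.1 2 2) - deriv B.L (p.1.1 2 2) * (1 - p.1.1 2 2 ^ 2)) * B.Ω p 2)) := by
  obtain ⟨e3, e4⟩ := B.tau_eq hp
  have hP := (B.P_pos (B.third_mem hp)).ne'
  rw [B.qpVec_apply, e3, e4, B.QP_zero_zero, B.QP_zero_one, B.deriv_ϱ_eq (B.third_mem hp)]
  field_simp
  simp only [P, σ]
  ring

theorem qpVec_one {p : Phase} (hp : p ∈ B.phase) :
    B.qpVec p 1 = B.m * ((B.ϱ (p.1.1 2 2) * B.L (p.1.1 2 2) +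
        deriv B.L (p.1.1 2 2) * B.ζ (p.1.1 2 2)) *
          (p.1.1 2 0 * B.Ω p 0 + p.1.1 2 1 * B.Ω p 1) +
      B.ϱ (p.1.1 2 2) * (B.L (p.1.1 2 2) * p.1.1 2 2 -
        deriv B.L (p.1.1 2 2) * (1 - p.1.1 2 2 ^ 2)) * B.Ω p 2) := by
  obtain ⟨e3, e4⟩ := B.tau_eq hp
  have hP := (B.P_pos (B.third_mem hp)).ne'
  rw [B.qpVec_apply, e3, e4, B.QP_one_zero, B.QP_one_one]
  field_simp
  simp only [P, σ, L]
  ring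

theorem JK_identity {p : Phase} (hp : p ∈ B.phase) (u N u' N' : Vec3) :
    B.JK p (B.constrainedVec p u N) (B.constrainedVec p u' N') -
      B.m * B.ϱ (p.1.1 2 2) * (p.1.1 2 ⬝ᵥ B.s (p.1.1 2)) * (B.Ω p ⬝ᵥ (u' ⨯₃ u)) =
      B.qpVec p 0 * (p.1.1 2 ⬝ᵥ (u' ⨯₃ u)) + B.qpVec p 1 * (u' ⨯₃ u) 2 := by
  have hk := B.third_sq hp
  rw [B.JK_constrained hp, B.qpVec_zero hp, B.qpVec_one hp]
  generalize u' ⨯₃ u = d at *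
  generalize deriv B.L (p.1.1 2 2) = l at *
  simp only [Vec3.dot_eq, Vec3.cross_zero, Vec3.cross_one, Vec3.cross_two, s_zero, s_one, s_two, L,
    Pi.sub_apply, Pi.smul_apply, smul_eq_mul, Matrix.cons_val]
  generalize p.1.1 2 = γ at *
  generalize B.Ω p = w at *
  linear_combination (B.m * l * B.ϱ (γ 2) * w 2 *
    (γ 2 * (γ 0 * d 0 + γ 1 * d 1 + γ 2 * d 2) - d 2)) * hk

/-! ### Evolution of `j₁` and `j₂` along the nonholonomic flow. -/

/-- Axial symmetry removes the third components of `Ω × 𝕀Ω` and of the gravity torque `s × γ`; the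
rest has the factor `γ̇₃ = (γ × Ω)₃`. -/
theorem momentumRate_two {p : Phase} (hp : p ∈ B.phase) :
    B.momentumRate p 2 = (p.1.1 2 ⨯₃ B.Ω p) 2 * B.qpVec p 0 := by
  have hk := B.third_sq hp
  rw [momentumRate, B.qpVec_zero hp, B.fderiv_s_cross (B.third_mem hp)]
  generalize deriv B.L (p.1.1 2 2) = l at *
  simp only [Vec3.cross_zero, Vec3.cross_one, Vec3.cross_two, s_zero, s_one, s_two,
    Pi.sub_apply, Pi.add_apply, Pi.smul_apply, smul_eq_mul, Matrix.cons_val, inertia_zero,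
    inertia_one]
  generalize p.1.1 2 = γ at *
  generalize B.Ω p = w at *
  linear_combination (B.m * l * γ 2 * B.ϱ (γ 2) * w 2 * (γ 0 * w 1 - γ 1 * w 0)) * hk

/-- Gravity exerts no torque about the vertical `γ`, and the term `Ω × 𝕀Ω` is balanced by `⟨γ × Ω,
𝕀Ω⟩`. -/
theorem dot_momentumRate {p : Phase} (hp : p ∈ B.phase) :
    (p.1.1 2 ⨯₃ B.Ω p) ⬝ᵥ p.2 + p.1.1 2 ⬝ᵥ B.momentumRate p =
      -((p.1.1 2 ⨯₃ B.Ω p) 2 * B.qpVec p 1) := by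
  have hk := B.third_sq hp
  rw [Vec3.dot_eq _ p.2, B.momentum_coord p 0, B.momentum_coord p 1, B.momentum_coord p 2,
    momentumRate, B.qpVec_one hp, B.fderiv_s_cross (B.third_mem hp)]
  generalize deriv B.L (p.1.1 2 2) = l at *
  simp only [Vec3.dot_eq, Vec3.cross_zero, Vec3.cross_one, Vec3.cross_two, s_zero, s_one, s_two, L,
    Pi.sub_apply, Pi.add_apply, Pi.smul_apply, smul_eq_mul, Matrix.cons_val, inertia_zero,
    inertia_one, inertia_two]
  generalize p.1.1 2 = γ at *
  generalize B.Ω p = w at *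
  linear_combination (B.m * l * B.ϱ (γ 2) * w 2 * (γ 0 * w 1 - γ 1 * w 0)) * hk

/-- Every vector of `𝓒` is the velocity of a curve in `𝓜`. -/
theorem exists_curve {p : Phase} (hp : p ∈ B.phase) (u N : Vec3) :
    ∃ c : ℝ → Phase, c 0 = p ∧ (∀ t, c t ∈ B.phase) ∧
      HasDerivAt c (B.constrainedVec p u N) 0 := by
  have hg := B.isRot_of_mem hp
  set ga : ℝ → Vec3 := fun t => cayleyRow u t (p.1.1 2) with hga
  set δa : Vec3 := -rowsMul p.1.1 (u ⨯₃ B.s (p.1.1 2)) with hδa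
  have hga' : HasDerivAt ga (p.1.1 2 ⨯₃ u) 0 := hasDerivAt_cayleyRow u _
  have hga0 : ga 0 = p.1.1 2 := cayleyRow_zero u _
  have hs : HasDerivAt (fun t => B.s (ga t)) (fderiv ℝ B.s (p.1.1 2) (p.1.1 2 ⨯₃ u)) 0 :=
    HasFDerivAt.comp_hasDerivAt_of_eq 0
      (B.differentiableAt_s (B.third_mem hp)).hasFDerivAt hga' hga0.symm
  -- The height is defined by the constraint of `Q`, so the curve stays in `𝓜` exactly.
  refine ⟨fun t => ((fun i => cayleyRow u t (p.1.1 i),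
    ![p.1.2 0 + t * δa 0, p.1.2 1 + t * δa 1, -(ga t ⬝ᵥ B.s (ga t))]), p.2 + t • N), ?_,
    fun t => ⟨hg.cayleyRow u t, rfl⟩, ?_⟩
  · refine Prod.ext (Prod.ext (funext fun i => cayleyRow_zero u _) ?_) (by simp)
    apply Vec3.ext_coord
    · simp
    · simp
    · simpa [hga0] using hp.2.symm
  · refine HasDerivAt.prodMk (HasDerivAt.prodMk
      (hasDerivAt_pi.2 fun i => hasDerivAt_cayleyRow u _) (hasDerivAt_pi.2 fun i => ?_))
      (hasDerivAt_line p.2 N)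
    fin_cases i
    · simpa [hδa] using (((hasDerivAt_id' (0 : ℝ)).mul_const (δa 0)).const_add (p.1.2 0))
    · simpa [hδa] using (((hasDerivAt_id' (0 : ℝ)).mul_const (δa 1)).const_add (p.1.2 1))
    · refine (hga'.dotVec3 hs).neg.congr_deriv ?_
      -- Since `γ` is normal to the surface, the variation of `s` does not change the height to
      -- first order.
      rw [hga0, B.dot_fderiv_s hg.third_dot_self]
      simp only [Fin.reduceFinMk, Pi.neg_apply, rowsMul, Vec3.dot_eq, Vec3.cross_zero,
        Vec3.cross_one, Vec3.cross_two]
      ring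

/-- `𝓜` has empty interior, so the derivative within it is evaluated by the chain rule along a curve
in `𝓜` with velocity `X_nh`. The coordinate `γ₃` stays in `[-1, 1]`, so derivatives of `f, g` within
that interval suffice. -/
theorem fderivWithin_gaugeCombination {p : Phase} (hp : p ∈ B.phase) {f g : ℝ → ℝ} {f' g' : ℝ}
    (hf : HasDerivWithinAt f f' (Set.Icc (-1) 1) (p.1.1 2 2))
    (hg : HasDerivWithinAt g g' (Set.Icc (-1) 1) (p.1.1 2 2))
    (hJ : DifferentiableWithinAt ℝ (gaugeCombination f g) B.phase p) :
    fderivWithin ℝ (gaugeCombination f g) B.phase p (B.Xnh p) =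
      (p.1.1 2 ⨯₃ B.Ω p) 2 * (f' * j₁ p + g' * j₂ p -
        (f (p.1.1 2 2) * B.qpVec p 0 + g (p.1.1 2 2) * B.qpVec p 1)) := by
  obtain ⟨c, hc0, hc, hc'⟩ := B.exists_curve hp (B.Ω p) (B.momentumRate p)
  rw [B.Xnh_eq hp]
  have h1 := HasFDerivWithinAt.comp_hasDerivAt_of_eq 0 hJ.hasFDerivWithinAt hc'
    (Filter.Eventually.of_forall hc) hc0.symm
  have hγ : HasDerivAt (fun t => (c t).1.1 2) (p.1.1 2 ⨯₃ B.Ω p) 0 :=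
    hasDerivAt_pi.1 hc'.fst.fst 2
  have hM : HasDerivAt (fun t => (c t).2) (B.momentumRate p) 0 := hc'.snd
  have hγ3 := hasDerivAt_pi.1 hγ 2
  have hM3 := hasDerivAt_pi.1 hM 2
  have hmem : ∀ t, (c t).1.1 2 2 ∈ Set.Icc (-1 : ℝ) 1 := fun t => B.third_mem (hc t)
  have ef := hf.comp_hasDerivAt_of_eq 0 hγ3 (Filter.Eventually.of_forall hmem) (by rw [hc0])
  have eg := hg.comp_hasDerivAt_of_eq 0 hγ3 (Filter.Eventually.of_forall hmem) (by rw [hc0])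
  have h2 := (ef.mul hM3.neg).add (eg.mul (hγ.dotVec3 hM))
  rw [h1.unique h2]
  simp only [Function.comp, hc0, j₁, j₂]
  simp only [Pi.neg_apply]
  have hr2 := B.momentumRate_two hp
  have hr := B.dot_momentumRate hp
  simp only [hc0]
  linear_combination (-f (p.1.1 2 2)) * hr2 + g (p.1.1 2 2) * hr

end RollingBody

/-! ### Infinitesimal generators and sections of `𝔤_S`. -/

theorem IsRot.eq_of_rows {g : Fin 3 → Vec3} (hg : IsRot g) {a b : Vec3}
    (h : ∀ i, g i ⬝ᵥ a = g i ⬝ᵥ b) : a = b := by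
  have e : rowsMul g (a - b) = 0 := by
    ext i
    simp [rowsMul, dotProduct_sub, h i]
  have h0 := hg.rowsMul_dot (a - b) (a - b)
  rw [e, zero_dotProduct] at h0
  exact sub_eq_zero.1 (dotProduct_self_eq_zero.1 h0.symm)

theorem IsRot.det_eq {g : Fin 3 → Vec3} (hg : IsRot g) : g 0 ⬝ᵥ (g 1 ⨯₃ g 2) = 1 := by
  have h := (Matrix.mem_specialOrthogonalGroup_iff.1 hg).2
  rw [Matrix.det_fin_three] at h
  simp only [Matrix.of_apply] at h
  simp only [Vec3.dot_eq, Vec3.cross_zero, Vec3.cross_one, Vec3.cross_two]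
  linear_combination h

theorem IsRot.one_cross_two {g : Fin 3 → Vec3} (hg : IsRot g) : g 1 ⨯₃ g 2 = g 0 := by
  refine hg.eq_of_rows fun i => ?_
  fin_cases i
  · simp [hg.det_eq, hg.row]
  · simp [hg.row]
  · simp [hg.row]

theorem IsRot.zero_cross_two {g : Fin 3 → Vec3} (hg : IsRot g) : g 0 ⨯₃ g 2 = -g 1 := by
  have h := hg.det_eq
  refine hg.eq_of_rows fun i => ?_
  fin_cases i
  · simp [hg.row]
  · have : g 1 ⬝ᵥ (g 0 ⨯₃ g 2) = -1 := by
      rw [← h]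
      simp only [Vec3.dot_eq, Vec3.cross_zero, Vec3.cross_one, Vec3.cross_two]
      ring
    simp [this, hg.row]
  · simp [hg.row]

theorem hasDerivAt_rotZ (a : ℝ) {v : ℝ → Vec3} {v' : Vec3} (hv : HasDerivAt v v' 0) :
    HasDerivAt (fun t : ℝ => rotZ (t * a) (v t)) (v' + a • ![-v 0 1, v 0 0, 0]) 0 := by
  have h := hasDerivAt_pi.1 hv
  have ha : HasDerivAt (fun t : ℝ => t * a) a 0 := by
    simpa using (hasDerivAt_id' (0 : ℝ)).mul_const a
  have hc := ha.cos
  have hs := ha.sin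
  refine hasDerivAt_pi.2 fun i => ?_
  fin_cases i
  · refine ((hc.mul (h 0)).sub (hs.mul (h 1))).congr_deriv ?_
    simp; ring
  · refine ((hs.mul (h 0)).add (hc.mul (h 1))).congr_deriv ?_
    simp; ring
  · refine (h 2).congr_deriv ?_
    simp

theorem hasDerivAt_configAct (ξ : BodySymAlg) (q : Config) :
    HasDerivAt (fun t : ℝ => configAct (t * ξ.1) (t * ξ.2.1) (t * ξ.2.2.1) (t * ξ.2.2.2) q)
      (fun i => ξ.1 • ![-q.1 i 1, q.1 i 0, 0] + ξ.2.1 • (![-q.1 1, q.1 0, 0] : Fin 3 → Vec3) i,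
        ξ.2.1 • ![-q.2 1, q.2 0, 0] + ![ξ.2.2.1, ξ.2.2.2, 0]) 0 := by
  have hrow : ∀ k, HasDerivAt (fun t : ℝ => rotZ (t * ξ.1) (q.1 k))
      (ξ.1 • ![-q.1 k 1, q.1 k 0, 0]) 0 := fun k => by
    simpa using hasDerivAt_rotZ ξ.1 (hasDerivAt_const (0 : ℝ) (q.1 k))
  have hz : ∀ v : Vec3, rotZ 0 v = v := fun v => by
    apply Vec3.ext_coord <;> simp [rotZ]
  refine HasDerivAt.prodMk (hasDerivAt_pi.2 fun i => hasDerivAt_pi.2 fun j => ?_) ?_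
  · have hcol : HasDerivAt (fun t : ℝ => (fun k => rotZ (t * ξ.1) (q.1 k) j : Vec3))
        (fun k => (ξ.1 • ![-q.1 k 1, q.1 k 0, 0]) j) 0 :=
      hasDerivAt_pi.2 fun k => hasDerivAt_pi.1 (hrow k) j
    refine (hasDerivAt_pi.1 (hasDerivAt_rotZ ξ.2.1 hcol) i).congr_deriv ?_
    fin_cases i <;> fin_cases j <;> simp [hz]
  · have h1 : HasDerivAt (fun t : ℝ => rotZ (t * ξ.2.1) q.2)
        (ξ.2.1 • ![-q.2 1, q.2 0, 0]) 0 := by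
      simpa using hasDerivAt_rotZ ξ.2.1 (hasDerivAt_const (0 : ℝ) q.2)
    refine h1.add (hasDerivAt_pi.2 fun i => ?_)
    have hl : ∀ c : ℝ, HasDerivAt (fun t : ℝ => t * c) c 0 := fun c => by
      simpa using (hasDerivAt_id' (0 : ℝ)).mul_const c
    fin_cases i
    exacts [hl _, hl _, hasDerivAt_const _ _]

theorem phaseGen_fst (ξ : BodySymAlg) (p : Phase) : (phaseGen ξ p).1 = configGen ξ p.1 := by
  have h := (hasDerivAt_configAct ξ p.1).prodMk
    (hasDerivAt_rotZ ξ.1 (hasDerivAt_const (0 : ℝ) p.2))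
  have e : phaseGen ξ p = _ := h.deriv
  rw [e, configGen, (hasDerivAt_configAct ξ p.1).deriv]

/-- The body angular velocity of the infinitesimal generator: `φ γ - θ e₃`. -/
def genAngVel (θ φ : ℝ) (γ : Vec3) : Vec3 := φ • γ - θ • ![0, 0, 1]

theorem configGen_eq {q : Config} (hq : IsRot q.1) (ξ : BodySymAlg) :
    configGen ξ q = (fun i => q.1 i ⨯₃ genAngVel ξ.1 ξ.2.1 (q.1 2),
      ξ.2.1 • ![-q.2 1, q.2 0, 0] + ![ξ.2.2.1, ξ.2.2.2, 0]) := by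
  rw [configGen, (hasDerivAt_configAct ξ q).deriv]
  refine Prod.ext (funext fun i => ?_) rfl
  have e : ∀ v : Vec3, v ⨯₃ ![0, 0, 1] = -![-v 1, v 0, 0] := fun v => by
    apply Vec3.ext_coord <;> simp [Vec3.cross_zero, Vec3.cross_one, Vec3.cross_two]
  simp only [genAngVel, map_sub, map_smul, e]
  fin_cases i
  · simp [hq.zero_cross_two, add_comm]
    ring
  · simp [hq.one_cross_two, add_comm]
    ring
  · simp

namespace RollingBody

variable (B : RollingBody)

/-- The section of `𝔤_S` with rotational components `f(γ₃)` and `g(γ₃)`; its translational part is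
determined by the constraint. -/
noncomputable def gaugeSection (f g : ℝ → ℝ) (q : Config) : BodySymAlg :=
  (f (q.1 2 2), g (q.1 2 2),
    -(q.1 0 ⬝ᵥ (genAngVel (f (q.1 2 2)) (g (q.1 2 2)) (q.1 2) ⨯₃ B.s (q.1 2))) +
      g (q.1 2 2) * q.2 1,
    -(q.1 1 ⬝ᵥ (genAngVel (f (q.1 2 2)) (g (q.1 2 2)) (q.1 2) ⨯₃ B.s (q.1 2))) -
      g (q.1 2 2) * q.2 0)

/-- Translations can correct only the horizontal components. The vertical one agrees on its own,
since `γ`, `e₃` and `s` are coplanar. -/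
theorem configGen_gaugeSection (f g : ℝ → ℝ) {q : Config} (hq : q ∈ B.Q) :
    configGen (B.gaugeSection f g q) q =
      (fun i => q.1 i ⨯₃ genAngVel (f (q.1 2 2)) (g (q.1 2 2)) (q.1 2),
        -rowsMul q.1 (genAngVel (f (q.1 2 2)) (g (q.1 2 2)) (q.1 2) ⨯₃ B.s (q.1 2))) := by
  rw [configGen_eq hq.1]
  refine Prod.ext rfl ?_
  apply Vec3.ext_coord
  · simp [gaugeSection, rowsMul]
  · simp [gaugeSection, rowsMul]
  · simp only [Pi.add_apply, Pi.smul_apply, Matrix.cons_val, add_zero, Pi.neg_apply,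
      rowsMul, genAngVel, Vec3.dot_eq, Vec3.cross_zero, Vec3.cross_one, Vec3.cross_two,
      Pi.sub_apply, smul_eq_mul, s_zero, s_one, s_two]
    ring

theorem gaugeSection_mem (f g : ℝ → ℝ) {q : Config} (hq : q ∈ B.Q) :
    B.gaugeSection f g q ∈ B.gS q :=
  ⟨⟨_, B.configGen_gaugeSection f g hq⟩, ⟨_, rfl⟩⟩

/-- On a vector of `D` with angular velocity `u` the Liouville form equals `⟨M, u⟩`, and here `u = g
γ - f e₃`. -/
theorem liouville_gaugeSection (f g : ℝ → ℝ) {p : Phase} (hp : p ∈ B.phase) :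
    B.liouville p (phaseGen (B.gaugeSection f g p.1) p) = gaugeCombination f g p := by
  have hg := B.isRot_of_mem hp
  unfold liouville
  rw [phaseGen_fst, B.configGen_gaugeSection f g hp]
  simp only [centreVel, hg.mcForm_cross, neg_dotProduct_neg, hg.rowsMul_dot]
  simp only [gaugeCombination, j₁, j₂, Vec3.dot_eq, B.momentum_coord p, inertia_zero, inertia_one,
    inertia_two, Vec3.cross_zero, Vec3.cross_one, Vec3.cross_two, genAngVel, Pi.sub_apply,
    Pi.smul_apply, smul_eq_mul, Matrix.cons_val]
  ring

end RollingBody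

/-! ### Smoothness of the sections and of their momenta. -/

section smoothness

variable {E : Type*} [NormedAddCommGroup E] [NormedSpace ℝ E]

theorem ContDiffOn.dotVec3 {n : WithTop ℕ∞} {A B : E → Vec3} {S : Set E} (hA : ContDiffOn ℝ n A S)
    (hB : ContDiffOn ℝ n B S) : ContDiffOn ℝ n (fun y => A y ⬝ᵥ B y) S := by
  have a := contDiffOn_pi.1 hA
  have b := contDiffOn_pi.1 hB
  simp only [Vec3.dot_eq]
  exact (((a 0).mul (b 0)).add ((a 1).mul (b 1))).add ((a 2).mul (b 2))

theorem ContDiffOn.crossVec3 {n : WithTop ℕ∞} {A B : E → Vec3} {S : Set E}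
    (hA : ContDiffOn ℝ n A S) (hB : ContDiffOn ℝ n B S) :
    ContDiffOn ℝ n (fun y => A y ⨯₃ B y) S := by
  have a := contDiffOn_pi.1 hA
  have b := contDiffOn_pi.1 hB
  refine contDiffOn_pi.2 fun i => ?_
  fin_cases i
  · simpa only [Fin.zero_eta, Vec3.cross_zero] using ((a 1).mul (b 2)).sub ((a 2).mul (b 1))
  · simpa only [Fin.mk_one, Vec3.cross_one] using ((a 2).mul (b 0)).sub ((a 0).mul (b 2))
  · simpa only [Fin.reduceFinMk, Vec3.cross_two] using ((a 0).mul (b 1)).sub ((a 1).mul (b 0))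

end smoothness

namespace RollingBody

variable (B : RollingBody)

theorem contDiffOn_gaugeSection {f g : ℝ → ℝ} (hf : B.SmoothOnQ f) (hg : B.SmoothOnQ g) :
    ContDiffOn ℝ ∞ (B.gaugeSection f g) B.Q := by
  have hrow : ∀ i, ContDiffOn ℝ ∞ (fun q : Config => q.1 i) B.Q := fun i =>
    (contDiff_pi.1 contDiff_fst i).contDiffOn
  have ha : ∀ i, ContDiffOn ℝ ∞ (fun q : Config => q.2 i) B.Q := fun i =>
    (contDiff_pi.1 contDiff_snd i).contDiffOn
  have hs : ContDiffOn ℝ ∞ (fun q : Config => B.s (q.1 2)) B.Q := fun q hq =>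
    ((B.contDiffAt_s (IsRot.third_mem_Icc hq.1)).comp q
      (contDiff_pi.1 contDiff_fst 2).contDiffAt).contDiffWithinAt
  have hu : ContDiffOn ℝ ∞
      (fun q : Config => genAngVel (f (q.1 2 2)) (g (q.1 2 2)) (q.1 2)) B.Q :=
    (hg.smul (hrow 2)).sub (hf.smul contDiffOn_const)
  have hus := hu.crossVec3 hs
  exact hf.prodMk (hg.prodMk ((((hrow 0).dotVec3 hus).neg.add (hg.mul (ha 1))).prodMk
    (((hrow 1).dotVec3 hus).neg.sub (hg.mul (ha 0)))))

theorem contDiffOn_gaugeCombination {f g : ℝ → ℝ} (hf : B.SmoothOnQ f) (hg : B.SmoothOnQ g) :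
    ContDiffOn ℝ ∞ (gaugeCombination f g) B.phase := by
  have hfst : Set.MapsTo (Prod.fst : Phase → Config) B.phase B.Q := fun p hp => hp
  have hf' : ContDiffOn ℝ ∞ (fun p : Phase => f (p.1.1 2 2)) B.phase :=
    hf.comp contDiff_fst.contDiffOn hfst
  have hg' : ContDiffOn ℝ ∞ (fun p : Phase => g (p.1.1 2 2)) B.phase :=
    hg.comp contDiff_fst.contDiffOn hfst
  have hM : ContDiffOn ℝ ∞ (fun p : Phase => p.2) B.phase := contDiff_snd.contDiffOn
  have hγ : ContDiffOn ℝ ∞ (fun p : Phase => p.1.1 2) B.phase :=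
    (contDiff_pi.1 (contDiff_fst.comp contDiff_fst) 2).contDiffOn
  exact (hf'.mul (contDiffOn_pi.1 hM 2).neg).add (hg'.mul (hγ.dotVec3 hM))

/-- A combination `f(τ₁) j₁ + g(τ₁) j₂` is a horizontal gauge momentum as soon as it is conserved. -/
theorem isHorizontalGaugeMomentum_iff {f g : ℝ → ℝ} (hf : B.SmoothOnQ f) (hg : B.SmoothOnQ g) :
    B.IsHorizontalGaugeMomentum (gaugeCombination f g) ↔
      ∀ p ∈ B.phase, fderivWithin ℝ (gaugeCombination f g) B.phase p (B.Xnh p) = 0 :=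
  ⟨fun h => h.2.2, fun h => ⟨B.contDiffOn_gaugeCombination hf hg,
    ⟨B.gaugeSection f g, B.contDiffOn_gaugeSection hf hg, fun _ hq => B.gaugeSection_mem f g hq,
      fun _ hp => (B.liouville_gaugeSection f g hp).symm⟩, h⟩⟩

end RollingBody

/-! ### Linear differential equations on a compact interval. -/

section linear

open Set

variable {ι : Type*} [Fintype ι]

/-- Coordinatewise truncation to `[-R, R]`. -/
noncomputable def clampVec (R : ℝ) (x : ι → ℝ) : ι → ℝ := fun i => max (-R) (min R (x i))

theorem abs_clamp_le {R t : ℝ} (hR : 0 ≤ R) : |max (-R) (min R t)| ≤ R :=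
  abs_le.2 ⟨le_max_left _ _, max_le (by linarith) (min_le_left _ _)⟩

theorem norm_clampVec_le {R : ℝ} (hR : 0 ≤ R) (x : ι → ℝ) : ‖clampVec R x‖ ≤ R :=
  (pi_norm_le_iff_of_nonneg hR).2 fun _ => abs_clamp_le hR

theorem norm_clampVec_le_norm {R : ℝ} (hR : 0 ≤ R) (x : ι → ℝ) : ‖clampVec R x‖ ≤ ‖x‖ := by
  refine (pi_norm_le_iff_of_nonneg (norm_nonneg x)).2 fun i => ?_
  have h := norm_le_pi_norm x i
  refine le_trans ?_ h
  rw [Real.norm_eq_abs, Real.norm_eq_abs, clampVec, abs_le]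
  constructor
  · refine le_max_of_le_right (le_min ?_ (neg_abs_le _))
    linarith [abs_nonneg (x i)]
  · refine max_le ?_ (min_le_of_right_le (le_abs_self _))
    linarith [abs_nonneg (x i)]

theorem clampVec_eq_self {R : ℝ} {x : ι → ℝ} (hx : ‖x‖ ≤ R) : clampVec R x = x := by
  ext i
  have h := abs_le.1 ((norm_le_pi_norm x i).trans hx)
  simp [clampVec, h.1, h.2]

theorem lipschitzWith_clampVec (R : ℝ) : LipschitzWith 1 (clampVec R : (ι → ℝ) → ι → ℝ) := by
  refine LipschitzWith.of_dist_le_mul fun x y => ?_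
  simp only [NNReal.coe_one, one_mul]
  refine (dist_pi_le_iff dist_nonneg).2 fun i => le_trans ?_ (dist_le_pi_dist x y i)
  have h : LipschitzWith 1 fun t : ℝ => max (-R) (min R t) :=
    (LipschitzWith.id.const_min R).const_max (-R)
  simpa [clampVec] using h.dist_le_mul (x i) (y i)

theorem norm_mulVec_le_of_sum_le {A : Matrix ι ι ℝ} {K : ℝ} (hA : ∑ i, ∑ j, |A i j| ≤ K)
    (x : ι → ℝ) : ‖A *ᵥ x‖ ≤ K * ‖x‖ := by
  have hK : 0 ≤ K := le_trans (Finset.sum_nonneg fun i _ => Finset.sum_nonneg fun j _ =>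
    abs_nonneg _) hA
  refine (pi_norm_le_iff_of_nonneg (by positivity)).2 fun i => ?_
  calc ‖(A *ᵥ x) i‖ ≤ ∑ j, ‖A i j * x j‖ := norm_sum_le _ _
    _ ≤ ∑ j, |A i j| * ‖x‖ := Finset.sum_le_sum fun j _ => by
        rw [norm_mul]
        exact mul_le_mul_of_nonneg_left (norm_le_pi_norm x j) (norm_nonneg _)
    _ = (∑ j, |A i j|) * ‖x‖ := by rw [Finset.sum_mul]
    _ ≤ K * ‖x‖ := by
        refine mul_le_mul_of_nonneg_right (le_trans ?_ hA) (norm_nonneg x)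
        exact Finset.single_le_sum (f := fun i => ∑ j, |A i j|)
          (fun i _ => Finset.sum_nonneg fun j _ => abs_nonneg _) (Finset.mem_univ i)

/-- A linear system with continuous coefficients on a compact interval has a solution on the whole
interval. -/
theorem exists_linear_ode_solution {A : ℝ → Matrix ι ι ℝ} {a b : ℝ} (hab : a ≤ b)
    (hA : ∀ i j, ContinuousOn (fun t => A t i j) (Icc a b)) (x₀ : ι → ℝ) :
    ∃ x : ℝ → ι → ℝ, x a = x₀ ∧
      ∀ t ∈ Icc a b, HasDerivWithinAt x (A t *ᵥ x t) (Icc a b) t := by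
  obtain ⟨K₀, hK₀⟩ := (isCompact_Icc (a := a) (b := b)).exists_bound_of_continuousOn
    (f := fun t => ∑ i, ∑ j, |A t i j|)
    (continuousOn_finsetSum _ fun i _ => continuousOn_finsetSum _ fun j _ => (hA i j).abs)
  set K : NNReal := K₀.toNNReal with hKdef
  have hK : ∀ t ∈ Icc a b, ∀ x : ι → ℝ, ‖A t *ᵥ x‖ ≤ K * ‖x‖ := fun t ht x =>
    norm_mulVec_le_of_sum_le (((le_abs_self _).trans (hK₀ t ht)).trans (Real.le_coe_toNNReal _)) x
  -- This is the Grönwall bound for the linear system on the whole interval, so truncation at `R`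
  -- will not affect the solution.
  set R : NNReal := ⟨‖x₀‖ * Real.exp (K * (b - a)), by positivity⟩ with hR
  have hRR : (R : ℝ) = ‖x₀‖ * Real.exp (K * (b - a)) := rfl
  have hlip : ∀ t ∈ Icc a b, LipschitzWith K fun x => A t *ᵥ clampVec (R : ℝ) x := by
    intro t ht
    refine LipschitzWith.of_dist_le_mul fun x y => ?_
    rw [dist_eq_norm, ← Matrix.mulVec_sub]
    refine (hK t ht _).trans (mul_le_mul_of_nonneg_left ?_ K.2)
    rw [← dist_eq_norm]
    simpa using (lipschitzWith_clampVec (R : ℝ)).dist_le_mul x y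
  -- The truncated field is bounded by `K R`, so a ball of radius `K R (b - a)` contains the
  -- solution for all times and no shorter interval is needed.
  have hpl : IsPicardLindelof (fun t x => A t *ᵥ clampVec (R : ℝ) x)
      (⟨a, left_mem_Icc.2 hab⟩ : Icc a b) x₀ (K * R * (b - a).toNNReal) 0 (K * R) K := by
    refine ⟨fun t ht => (hlip t ht).lipschitzOnWith, fun x _ => ?_, fun t ht x _ => ?_, ?_⟩
    · refine continuousOn_pi.2 fun i => ?_
      exact continuousOn_finsetSum _ fun j _ => (hA i j).mul continuousOn_const
    · refine (hK t ht _).trans ?_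
      rw [NNReal.coe_mul]
      exact mul_le_mul_of_nonneg_left (norm_clampVec_le R.2 x) K.2
    · have : 0 ≤ b - a := sub_nonneg.2 hab
      simp [this]
  obtain ⟨x, hx0, hx⟩ := hpl.exists_eq_forall_mem_Icc_hasDerivWithinAt₀
  have hbound : ∀ t ∈ Icc a b, ‖x t‖ ≤ R := by
    intro t ht
    have h := norm_le_gronwallBound_of_norm_deriv_right_le (f := x)
      (f' := fun t => A t *ᵥ clampVec (R : ℝ) (x t)) (δ := ‖x₀‖) (K := K) (ε := 0) (a := a) (b := b)
      (fun t ht => (hx t ht).continuousWithinAt)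
      (fun t ht => (hx t (Ico_subset_Icc_self ht)).mono_of_mem_nhdsWithin
        (Icc_mem_nhdsGE_of_mem ht))
      (by rw [← hx0])
      (fun t ht => by
        rw [add_zero]
        exact (hK t (Ico_subset_Icc_self ht) _).trans
          (mul_le_mul_of_nonneg_left (norm_clampVec_le_norm R.2 _) K.2)) t ht
    rw [gronwallBound_ε0] at h
    refine h.trans ?_
    rw [hRR]
    refine mul_le_mul_of_nonneg_left (Real.exp_le_exp.2 ?_) (norm_nonneg _)
    exact mul_le_mul_of_nonneg_left (by linarith [ht.2]) K.2
  refine ⟨x, hx0, fun t ht => ?_⟩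
  have := hx t ht
  rwa [clampVec_eq_self (hbound t ht)] at this

/-- Solutions of a linear system are smooth where the coefficients are. -/
theorem contDiffAt_linear_ode_solution {A : ℝ → Matrix ι ι ℝ} {x : ℝ → ι → ℝ} {z : ℝ}
    (hA : ∀ i j, ContDiffAt ℝ ∞ (fun t => A t i j) z)
    (hx : ∀ᶠ t in nhds z, HasDerivAt x (A t *ᵥ x t) t) : ContDiffAt ℝ ∞ x z := by
  rw [contDiffAt_infty]
  intro n
  induction n with
  | zero =>
    obtain ⟨u, hu, hxu⟩ := Filter.eventually_iff_exists_mem.1 hx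
    exact contDiffAt_zero.2 ⟨u, hu, fun t ht => (hxu t ht).continuousAt.continuousWithinAt⟩
  | succ n ih =>
    obtain ⟨u, hu, hxu⟩ := Filter.eventually_iff_exists_mem.1 hx
    rw [Nat.cast_add, Nat.cast_one, contDiffAt_succ_iff_hasFDerivAt]
    refine ⟨fun t => ContinuousLinearMap.toSpanSingleton ℝ (A t *ᵥ x t),
      ⟨u, hu, fun t ht => (hxu t ht).hasFDerivAt⟩, ?_⟩
    -- Bootstrapping: the derivative `A x` is as smooth as `x` itself.
    have h : ContDiffAt ℝ n (fun t => A t *ᵥ x t) z := by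
      refine contDiffAt_pi.2 fun i => ?_
      exact ContDiffAt.sum fun j _ =>
        (contDiffAt_infty.1 (hA i j) n).mul (contDiffAt_pi.1 ih j)
    exact (ContinuousLinearMap.toSpanSingletonCLE (𝕜 := ℝ) (E := ι → ℝ)).contDiff.contDiffAt.comp z h

/-- A solution of a scalar linear equation that vanishes somewhere vanishes at all earlier times. -/
theorem scalar_linear_ode_eq_zero {k w : ℝ → ℝ} {a z : ℝ} (hk : ContinuousOn k (Icc a z))
    (hw : ∀ t ∈ Icc a z, HasDerivWithinAt w (k t * w t) (Icc a z) t) (hz : w z = 0) (haz : a ≤ z) :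
    w a = 0 := by
  obtain ⟨K₀, hK₀⟩ := (isCompact_Icc (a := a) (b := z)).exists_bound_of_continuousOn hk
  have hlip : ∀ t ∈ Ioc a z, LipschitzOnWith K₀.toNNReal (fun y : ℝ => k t * y) univ := by
    intro t ht
    refine (LipschitzWith.of_dist_le_mul fun x y => ?_).lipschitzOnWith
    rw [dist_eq_norm, dist_eq_norm, ← mul_sub, norm_mul]
    exact mul_le_mul_of_nonneg_right ((hK₀ t (Ioc_subset_Icc_self ht)).trans
      (Real.le_coe_toNNReal _)) (norm_nonneg _)
  have h := ODE_solution_unique_of_mem_Icc_left (v := fun t y => k t * y) (s := fun _ => univ)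
    (f := w) (g := fun _ => 0) hlip (fun t ht => (hw t ht).continuousWithinAt)
    (fun t ht => (hw t (Ioc_subset_Icc_self ht)).mono_of_mem_nhdsWithin
      (Icc_mem_nhdsLE_of_mem ht)) (fun _ _ => trivial) continuousOn_const
    (fun t _ => by simpa using hasDerivWithinAt_const t (Iic t) (0 : ℝ))
    (fun _ _ => trivial) hz
  exact h (left_mem_Icc.2 haz)

end linear

/-- A function with continuously extendable derivative in the interior of an interval is
differentiable up to the end points. -/
theorem hasDerivWithinAt_Icc_of_Ioo {a b : ℝ} (hab : a < b) {f r : ℝ → ℝ}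
    (hf : ContinuousOn f (Set.Icc a b)) (hr : ContinuousOn r (Set.Icc a b))
    (hd : ∀ z ∈ Set.Ioo a b, HasDerivAt f (r z) z) :
    ∀ z ∈ Set.Icc a b, HasDerivWithinAt f (r z) (Set.Icc a b) z := by
  intro z hz
  have hdiff : DifferentiableOn ℝ f (Set.Ioo a b) := fun t ht =>
    (hd t ht).differentiableAt.differentiableWithinAt
  rcases eq_or_lt_of_le hz.1 with rfl | h1
  · refine (hasDerivWithinAt_Ici_of_tendsto_deriv hdiff
      ((hf a hz).mono Set.Ioo_subset_Icc_self) (Ioo_mem_nhdsGT hab) ?_).mono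
      Set.Icc_subset_Ici_self
    have h := ((hr a hz).mono Set.Ioo_subset_Icc_self).tendsto
    rw [nhdsWithin_Ioo_eq_nhdsGT hab] at h
    refine h.congr' ?_
    filter_upwards [Ioo_mem_nhdsGT hab] with t ht using (hd t ht).deriv.symm
  rcases eq_or_lt_of_le hz.2 with rfl | h2
  · refine (hasDerivWithinAt_Iic_of_tendsto_deriv hdiff
      ((hf z hz).mono Set.Ioo_subset_Icc_self) (Ioo_mem_nhdsLT hab) ?_).mono
      Set.Icc_subset_Iic_self
    have h := ((hr z hz).mono Set.Ioo_subset_Icc_self).tendsto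
    rw [nhdsWithin_Ioo_eq_nhdsLT hab] at h
    refine h.congr' ?_
    filter_upwards [Ioo_mem_nhdsLT hab] with t ht using (hd t ht).deriv.symm
  exact (hd z ⟨h1, h2⟩).hasDerivWithinAt

/-! ### Functions of `γ₃` and the equivalence with the linear system. -/

namespace RollingBody

variable (B : RollingBody)

/-- A meridian of configurations, with `γ = (sin θ, 0, cos θ)`. -/
noncomputable def meridian (θ : ℝ) : Config :=
  (![![Real.cos θ, 0, -Real.sin θ], ![0, 1, 0], ![Real.sin θ, 0, Real.cos θ]],
    ![0, 0, -(![Real.sin θ, 0, Real.cos θ] ⬝ᵥ B.s ![Real.sin θ, 0, Real.cos θ])])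

theorem meridian_mem (θ : ℝ) : B.meridian θ ∈ B.Q := by
  refine ⟨?_, rfl⟩
  have h := Real.sin_sq_add_cos_sq θ
  rw [Matrix.mem_specialOrthogonalGroup_iff, Matrix.mem_orthogonalGroup_iff]
  constructor
  · ext i j
    fin_cases i <;> fin_cases j <;>
      simp [meridian, Matrix.mul_apply, Fin.sum_univ_three] <;> linarith
  · rw [Matrix.det_fin_three]
    simp [meridian]
    linarith

theorem contDiff_meridian : ContDiff ℝ ∞ B.meridian := by
  have hγ : ContDiff ℝ ∞ fun θ : ℝ => (![Real.sin θ, 0, Real.cos θ] : Vec3) := by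
    refine contDiff_pi.2 fun i => ?_
    fin_cases i
    exacts [Real.contDiff_sin, contDiff_const, Real.contDiff_cos]
  have hs : ContDiff ℝ ∞ fun θ : ℝ => B.s ![Real.sin θ, 0, Real.cos θ] := by
    refine contDiff_iff_contDiffAt.2 fun θ => ?_
    exact (B.contDiffAt_s (by exact Real.cos_mem_Icc θ)).comp θ hγ.contDiffAt
  refine ContDiff.prodMk (contDiff_pi.2 fun i => ?_) (contDiff_pi.2 fun i => ?_)
  · fin_cases i
    · refine contDiff_pi.2 fun j => ?_
      fin_cases j
      exacts [Real.contDiff_cos, contDiff_const, Real.contDiff_sin.neg]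
    · exact contDiff_const
    · exact hγ
  · fin_cases i
    · exact contDiff_const
    · exact contDiff_const
    · exact contDiffOn_univ.1 ((contDiffOn_univ.2 hγ).dotVec3 (contDiffOn_univ.2 hs)).neg

variable {B} in
-- Restriction to a meridian turns smoothness on `Q` into smoothness in the polar angle. Inverting
-- the cosine then gives continuity of `f` on `[-1, 1]`, but differentiability only in the interior.
theorem SmoothOnQ.comp_cos {f : ℝ → ℝ} (hf : B.SmoothOnQ f) :
    ContDiff ℝ ∞ fun θ => f (Real.cos θ) :=
  ContDiffOn.comp_contDiff (g := fun q : Config => f (q.1 2 2)) hf B.contDiff_meridian B.meridian_mem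

variable {B} in
theorem SmoothOnQ.continuousOn {f : ℝ → ℝ} (hf : B.SmoothOnQ f) :
    ContinuousOn f (Set.Icc (-1) 1) := by
  refine (hf.comp_cos.continuous.comp Real.continuous_arccos).continuousOn.congr fun z hz => ?_
  simp [Real.cos_arccos hz.1 hz.2]

variable {B} in
theorem SmoothOnQ.differentiableAt {f : ℝ → ℝ} (hf : B.SmoothOnQ f) {z : ℝ}
    (hz : z ∈ Set.Ioo (-1 : ℝ) 1) : DifferentiableAt ℝ f z := by
  have h : DifferentiableAt ℝ (fun t => f (Real.cos (Real.arccos t))) z :=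
    DifferentiableAt.comp (g := fun θ => f (Real.cos θ)) z
      (hf.comp_cos.differentiable (by simp)).differentiableAt
      (Real.differentiableAt_arccos.2 ⟨hz.1.ne', hz.2.ne⟩)
  refine h.congr_of_eventuallyEq ?_
  filter_upwards [Ioo_mem_nhds hz.1 hz.2] with t ht
  rw [Real.cos_arccos ht.1.le ht.2.le]

theorem smoothOnQ_of_contDiffAt {f : ℝ → ℝ} (hf : ∀ z ∈ Set.Icc (-1 : ℝ) 1, ContDiffAt ℝ ∞ f z) :
    B.SmoothOnQ f := fun q hq =>
  ((hf _ (IsRot.third_mem_Icc hq.1)).comp q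
    (contDiff_pi.1 (contDiff_pi.1 contDiff_fst 2) 2).contDiffAt).contDiffWithinAt

theorem contDiffAt_QP {z : ℝ} (hz : z ∈ Set.Icc (-1 : ℝ) 1) (i j : Fin 2) :
    ContDiffAt ℝ ∞ (fun t => B.QP t i j) z := by
  have hr := B.ϱ_smooth z hz
  have hζ := B.ζ_smooth z hz
  have hr' := contDiffAt_deriv hr
  have hid : ContDiffAt ℝ ∞ (fun t : ℝ => t) z := contDiffAt_id
  have hL : ContDiffAt ℝ ∞ B.L z := (hr.mul hid).sub hζ
  have hL' := contDiffAt_deriv hL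
  have hσ : ContDiffAt ℝ ∞ B.σ z := by unfold σ; fun_prop
  have hP : ContDiffAt ℝ ∞ B.P z := by unfold P; fun_prop
  have hmP : ContDiffAt ℝ ∞ (fun t => B.m / B.P t) z :=
    contDiffAt_const.div hP (B.P_pos hz).ne'
  fin_cases i <;> fin_cases j
  · simp only [Fin.zero_eta, Fin.isValue, QP_zero_zero]; fun_prop
  · simp only [Fin.zero_eta, Fin.mk_one, Fin.isValue, QP_zero_one]; fun_prop
  · simp only [Fin.zero_eta, Fin.mk_one, Fin.isValue, QP_one_zero]; fun_prop
  · simp only [Fin.mk_one, Fin.isValue, QP_one_one]; fun_prop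

/-- The coefficient matrix of the linear system for `(f, g)`. -/
noncomputable def coeffMatrix (z : ℝ) : Matrix (Fin 2) (Fin 2) ℝ := !![z, -1; 1, 0] * (B.QP z)ᵀ

theorem coeffMatrix_zero (z : ℝ) (j : Fin 2) :
    B.coeffMatrix z 0 j = z * B.QP z j 0 - B.QP z j 1 := by
  simp [coeffMatrix, Matrix.mul_apply, Fin.sum_univ_two, sub_eq_add_neg]

theorem coeffMatrix_one (z : ℝ) (j : Fin 2) : B.coeffMatrix z 1 j = B.QP z j 0 := by
  simp [coeffMatrix, Matrix.mul_apply, Fin.sum_univ_two]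

theorem contDiffAt_coeffMatrix {z : ℝ} (hz : z ∈ Set.Icc (-1 : ℝ) 1) (i j : Fin 2) :
    ContDiffAt ℝ ∞ (fun t => B.coeffMatrix t i j) z := by
  fin_cases i
  · simp only [Fin.zero_eta, coeffMatrix_zero]
    exact (contDiffAt_id.mul (B.contDiffAt_QP hz j 0)).sub (B.contDiffAt_QP hz j 1)
  · simp only [Fin.mk_one, coeffMatrix_one]
    exact B.contDiffAt_QP hz j 0

theorem isSolution_iff {f g : ℝ → ℝ} : B.IsSolution f g ↔ ∀ z ∈ Set.Icc (-1 : ℝ) 1,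
    HasDerivWithinAt f (B.coeffMatrix z 0 0 * f z + B.coeffMatrix z 0 1 * g z)
      (Set.Icc (-1) 1) z ∧
    HasDerivWithinAt g (B.coeffMatrix z 1 0 * f z + B.coeffMatrix z 1 1 * g z)
      (Set.Icc (-1) 1) z := by
  unfold IsSolution
  refine forall₂_congr fun z _ => ?_
  rw [hasDerivWithinAt_pi, Fin.forall_fin_two, Matrix.mulVec_mulVec]
  change HasDerivWithinAt (fun t => f t) ((B.coeffMatrix z *ᵥ _) 0) _ _ ∧
    HasDerivWithinAt (fun t => g t) ((B.coeffMatrix z *ᵥ _) 1) _ _ ↔ _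
  simp [Matrix.mulVec, dotProduct, Fin.sum_univ_two]

theorem isHorizontalGaugeMomentum_of_isSolution {f g : ℝ → ℝ} (hf : B.SmoothOnQ f)
    (hg : B.SmoothOnQ g) (h : B.IsSolution f g) :
    B.IsHorizontalGaugeMomentum (gaugeCombination f g) := by
  refine (B.isHorizontalGaugeMomentum_iff hf hg).2 fun p hp => ?_
  obtain ⟨h1, h2⟩ := B.isSolution_iff.1 h _ (B.third_mem hp)
  rw [B.fderivWithin_gaugeCombination hp h1 h2
    ((B.contDiffOn_gaugeCombination hf hg).differentiableOn (by simp) p hp)]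
  rw [B.qpVec_apply, B.qpVec_apply]
  simp only [coeffMatrix_zero, coeffMatrix_one, j₁, j₂, Vec3.dot_eq]
  ring

theorem hasDerivAt_of_isHorizontalGaugeMomentum {f g : ℝ → ℝ} (hf : B.SmoothOnQ f)
    (hg : B.SmoothOnQ g) (h : B.IsHorizontalGaugeMomentum (gaugeCombination f g)) {z : ℝ}
    (hz : z ∈ Set.Ioo (-1 : ℝ) 1) :
    HasDerivAt f (B.coeffMatrix z 0 0 * f z + B.coeffMatrix z 0 1 * g z) z ∧
    HasDerivAt g (B.coeffMatrix z 1 0 * f z + B.coeffMatrix z 1 1 * g z) z := by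
  have hf' := (hf.differentiableAt hz).hasDerivAt
  have hg' := (hg.differentiableAt hz).hasDerivAt
  obtain ⟨θ, hθ⟩ : ∃ θ, θ = Real.arccos z := ⟨_, rfl⟩
  have hcos : Real.cos θ = z := by rw [hθ, Real.cos_arccos hz.1.le hz.2.le]
  have hsin : Real.sin θ ≠ 0 := by
    have h1 := Real.sin_sq_add_cos_sq θ
    rw [hcos] at h1
    intro h0
    rw [h0] at h1
    nlinarith [hz.1, hz.2]
  have key : ∀ x y : ℝ, deriv f z * (-y) + deriv g z * (Real.sin θ * x + z * y) =
      f z * (B.QP z 0 0 * (Real.sin θ * x) + B.QP z 0 1 * y) +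
      g z * (B.QP z 1 0 * (Real.sin θ * x) + B.QP z 1 1 * y) := by
    intro x y
    -- On the meridian `γ₂ = s₂ = 0`, so `M₂ = 1` forces `Ω₂ ≠ 0` and hence `γ̇₃ ≠ 0`. Meanwhile `τ₃
    -- = x sin θ` and `τ₄ = y` remain arbitrary.
    obtain ⟨p, hpdef⟩ : ∃ p : Phase, p = (B.meridian θ, ![x, 1, y]) := ⟨_, rfl⟩
    have hp : p ∈ B.phase := by rw [hpdef]; exact B.meridian_mem θ
    have g0 : p.1.1 2 0 = Real.sin θ := by rw [hpdef]; rfl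
    have g1 : p.1.1 2 1 = 0 := by rw [hpdef]; rfl
    have g2 : p.1.1 2 2 = z := by rw [hpdef, ← hcos]; rfl
    have m0 : p.2 0 = x := by rw [hpdef]; rfl
    have m1 : p.2 1 = 1 := by rw [hpdef]; rfl
    have m2 : p.2 2 = y := by rw [hpdef]; rfl
    have hΩ : B.Ω p 1 ≠ 0 := by
      intro h0
      have := B.momentum_coord p 1
      rw [m1, inertia_one, Vec3.cross_one, Vec3.cross_zero, Vec3.cross_two, s_one, g1, h0] at this
      simp at this
    have hJ := (B.isHorizontalGaugeMomentum_iff hf hg).1 h p hp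
    rw [B.fderivWithin_gaugeCombination hp (by rw [g2]; exact hf'.hasDerivWithinAt)
      (by rw [g2]; exact hg'.hasDerivWithinAt)
      ((B.contDiffOn_gaugeCombination hf hg).differentiableOn (by simp) p hp)] at hJ
    have hne : (p.1.1 2 ⨯₃ B.Ω p) 2 ≠ 0 := by
      rw [Vec3.cross_two, g0, g1]
      simpa using ⟨hsin, hΩ⟩
    have e := (mul_eq_zero.1 hJ).resolve_left hne
    rw [B.qpVec_apply, B.qpVec_apply, j₁, j₂, Vec3.dot_eq, g0, g1, g2, m0, m1, m2] at e
    linear_combination e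
  -- These choices are `(τ₃, τ₄) = (1, 0)` and `(0, 1)`, which isolate the two coefficients.
  have k1 := key (Real.sin θ)⁻¹ 0
  have k2 := key 0 1
  rw [mul_inv_cancel₀ hsin] at k1
  simp only [coeffMatrix_zero, coeffMatrix_one]
  refine ⟨hf'.congr_deriv ?_, hg'.congr_deriv ?_⟩
  · linear_combination z * k1 - k2
  · linear_combination k1

/-- Conservation gives the system only where `γ₃` can vary to first order, in the open interval. At
the poles the one-sided derivatives are limits of the continuous right-hand side. -/
theorem isHorizontalGaugeMomentum_gaugeCombination_iff {f g : ℝ → ℝ} (hf : B.SmoothOnQ f)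
    (hg : B.SmoothOnQ g) :
    B.IsHorizontalGaugeMomentum (gaugeCombination f g) ↔ B.IsSolution f g := by
  refine ⟨fun h => B.isSolution_iff.2 fun z hz => ?_,
    B.isHorizontalGaugeMomentum_of_isSolution hf hg⟩
  have hd := fun z hz => B.hasDerivAt_of_isHorizontalGaugeMomentum hf hg h (z := z) hz
  have hc : ∀ i j, ContinuousOn (fun t => B.coeffMatrix t i j) (Set.Icc (-1) 1) := fun i j t ht =>
    (B.contDiffAt_coeffMatrix ht i j).continuousAt.continuousWithinAt
  exact ⟨hasDerivWithinAt_Icc_of_Ioo (by norm_num) hf.continuousOn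
      (((hc 0 0).mul hf.continuousOn).add ((hc 0 1).mul hg.continuousOn))
      (fun z hz => (hd z hz).1) z hz,
    hasDerivWithinAt_Icc_of_Ioo (by norm_num) hg.continuousOn
      (((hc 1 0).mul hf.continuousOn).add ((hc 1 1).mul hg.continuousOn))
      (fun z hz => (hd z hz).2) z hz⟩

/-! ### Fundamental solutions and independence. -/

/-- The coefficients are continuous on a slightly larger interval. -/
theorem exists_continuousOn_coeffMatrix : ∃ ε > 0, ∀ i j,
    ContinuousOn (fun t => B.coeffMatrix t i j) (Set.Icc (-1 - ε) (1 + ε)) := by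
  have hev : ∀ z ∈ Set.Icc (-1 : ℝ) 1, ∀ᶠ t in nhds z, ∀ i j,
      ContinuousAt (fun t => B.coeffMatrix t i j) t := by
    intro z hz
    refine Filter.eventually_all.2 fun i => Filter.eventually_all.2 fun j => ?_
    -- Order `1` is taken because `ContDiffAt` of finite order persists nearby, whereas for order
    -- `∞` the neighbourhoods may shrink with the order.
    filter_upwards [((B.contDiffAt_coeffMatrix hz i j).of_le (m := 1) (by simp)).eventually
      (by simp)] with t ht using ht.continuousAt
  obtain ⟨ε₁, h1, H1⟩ := Metric.eventually_nhds_iff.1 (hev 1 (by norm_num))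
  obtain ⟨ε₂, h2, H2⟩ := Metric.eventually_nhds_iff.1 (hev (-1) (by norm_num))
  refine ⟨min ε₁ ε₂ / 2, by positivity, fun i j t ht => ContinuousAt.continuousWithinAt ?_⟩
  have m1 := min_le_left ε₁ ε₂
  have m2 := min_le_right ε₁ ε₂
  rcases lt_or_ge t (-1) with h | h
  · refine H2 ?_ i j
    rw [Real.dist_eq, abs_lt]
    constructor <;> linarith [ht.1]
  rcases lt_or_ge 1 t with h' | h'
  · refine H1 ?_ i j
    rw [Real.dist_eq, abs_lt]
    constructor <;> linarith [ht.2]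
  · exact (B.contDiffAt_coeffMatrix ⟨h, h'⟩ i j).continuousAt

/-- A fundamental system of smooth solutions with nowhere vanishing Wronskian. -/
theorem exists_fundamental_solutions : ∃ f₁ g₁ f₂ g₂ : ℝ → ℝ,
    (B.SmoothOnQ f₁ ∧ B.SmoothOnQ g₁ ∧ B.SmoothOnQ f₂ ∧ B.SmoothOnQ g₂) ∧
    B.IsSolution f₁ g₁ ∧ B.IsSolution f₂ g₂ ∧
    ∀ z ∈ Set.Icc (-1 : ℝ) 1, f₁ z * g₂ z - f₂ z * g₁ z ≠ 0 := by
  -- Solving beyond `[-1, 1]` makes the solutions smooth on both sides of `±1`, hence smooth on `Q`.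
  obtain ⟨ε, hε, hA⟩ := B.exists_continuousOn_coeffMatrix
  have hab : (-1 - ε) ≤ 1 + ε := by linarith
  have hnhds : ∀ z ∈ Set.Icc (-1 : ℝ) 1, ∀ᶠ t in nhds z, t ∈ Set.Ioo (-1 - ε) (1 + ε) :=
    fun z hz => Ioo_mem_nhds (by linarith [hz.1]) (by linarith [hz.2])
  have hsub : Set.Icc (-1 : ℝ) 1 ⊆ Set.Icc (-1 - ε) (1 + ε) :=
    Set.Icc_subset_Icc (by linarith) (by linarith)
  have props : ∀ x : ℝ → Fin 2 → ℝ, (∀ t ∈ Set.Icc (-1 - ε) (1 + ε),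
      HasDerivWithinAt x (B.coeffMatrix t *ᵥ x t) (Set.Icc (-1 - ε) (1 + ε)) t) →
      (∀ i, B.SmoothOnQ fun t => x t i) ∧ B.IsSolution (fun t => x t 0) (fun t => x t 1) := by
    intro x hx
    constructor
    · intro i
      refine B.smoothOnQ_of_contDiffAt fun z hz => contDiffAt_pi.1
        (contDiffAt_linear_ode_solution (B.contDiffAt_coeffMatrix hz) ?_) i
      filter_upwards [hnhds z hz] with t ht
      exact (hx t (Set.Ioo_subset_Icc_self ht)).hasDerivAt (Icc_mem_nhds ht.1 ht.2)
    · refine B.isSolution_iff.2 fun z hz => ?_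
      have h := hasDerivWithinAt_pi.1 ((hx z (hsub hz)).mono hsub)
      have e : ∀ i, (B.coeffMatrix z *ᵥ x z) i =
          B.coeffMatrix z i 0 * x z 0 + B.coeffMatrix z i 1 * x z 1 := fun i => by
        simp [Matrix.mulVec, dotProduct, Fin.sum_univ_two]
      exact ⟨(h 0).congr_deriv (e 0), (h 1).congr_deriv (e 1)⟩
  obtain ⟨x, hx0, hx⟩ := exists_linear_ode_solution hab hA ![1, 0]
  obtain ⟨y, hy0, hy⟩ := exists_linear_ode_solution hab hA ![0, 1]
  refine ⟨fun t => x t 0, fun t => x t 1, fun t => y t 0, fun t => y t 1,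
    ⟨(props x hx).1 0, (props x hx).1 1, (props y hy).1 0, (props y hy).1 1⟩,
    (props x hx).2, (props y hy).2, fun z hz h0 => ?_⟩
  have hsub' : Set.Icc (-1 - ε) z ⊆ Set.Icc (-1 - ε) (1 + ε) :=
    Set.Icc_subset_Icc_right (hsub hz).2
  -- Liouville's formula: the Wronskian satisfies `w' = (tr A) w`, so a zero would propagate back to
  -- the left end point, where `w = 1`.
  have hw := scalar_linear_ode_eq_zero (k := fun t => B.coeffMatrix t 0 0 + B.coeffMatrix t 1 1)
    (w := fun t => x t 0 * y t 1 - y t 0 * x t 1) (a := -1 - ε) (z := z)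
    (((hA 0 0).add (hA 1 1)).mono hsub') (fun t ht => ?_) h0 (hsub hz).1
  · simp [hx0, hy0] at hw
  · have h1 := hasDerivWithinAt_pi.1 ((hx t (hsub' ht)).mono hsub')
    have h2 := hasDerivWithinAt_pi.1 ((hy t (hsub' ht)).mono hsub')
    refine (((h1 0).mul (h2 1)).sub ((h2 0).mul (h1 1))).congr_deriv ?_
    simp [Matrix.mulVec, dotProduct, Fin.sum_univ_two]
    ring

theorem gaugeCombination_independent {f₁ g₁ f₂ g₂ : ℝ → ℝ}
    (hw : f₁ 0 * g₂ 0 - f₂ 0 * g₁ 0 ≠ 0) (c₁ c₂ : ℝ)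
    (h : ∀ p ∈ B.phase, c₁ * gaugeCombination f₁ g₁ p + c₂ * gaugeCombination f₂ g₂ p = 0) :
    c₁ = 0 ∧ c₂ = 0 := by
  have eval : ∀ (f g : ℝ → ℝ) (M : Vec3),
      gaugeCombination f g (B.meridian (Real.pi / 2), M) = -f 0 * M 2 + g 0 * M 0 := by
    intro f g M
    simp only [gaugeCombination, j₁, j₂, Vec3.dot_eq]
    simp [meridian]
  -- At `γ₃ = 0` the momenta `e₃` and `e₁` isolate the values `f(0)` and `g(0)`, and the Wronskian
  -- is the determinant of the resulting system for `c₁, c₂`, up to sign.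
  have e1 := h (B.meridian (Real.pi / 2), ![0, 0, 1]) (B.meridian_mem _)
  have e2 := h (B.meridian (Real.pi / 2), ![1, 0, 0]) (B.meridian_mem _)
  rw [eval, eval] at e1 e2
  simp at e1 e2
  constructor
  · refine (mul_eq_zero.1 (?_ : c₁ * (f₁ 0 * g₂ 0 - f₂ 0 * g₁ 0) = 0)).resolve_right hw
    linear_combination -g₂ 0 * e1 - f₂ 0 * e2
  · refine (mul_eq_zero.1 (?_ : c₂ * (f₁ 0 * g₂ 0 - f₂ 0 * g₁ 0) = 0)).resolve_right hw
    linear_combination g₁ 0 * e1 + f₁ 0 * e2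

end RollingBody

theorem theoremT (B : RollingBody) :
    -- the nonholonomic vector field is well defined
    (∀ p ∈ B.phase, ∃! v : Phase, B.IsNonholonomicVector p v) ∧
    -- the functions `(𝒬, 𝒫) = [𝒬𝒫] (τ₃, τ₄)ᵀ` satisfy
    -- `⟨𝒥, 𝒦_𝓦⟩ - m ϱ ⟨γ, s⟩ ⟨Ω, dλ⟩ = 𝒬 ⟨γ, dλ⟩ + 𝒫 dλ₃` on `𝓒`, where `dλ(v, w) = λ(w) × λ(v)`
    (∀ p ∈ B.phase, ∀ v ∈ B.C p, ∀ w ∈ B.C p,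
      let γ := p.1.1 2
      let dlam := mcForm p.1.1 w.1.1 ⨯₃ mcForm p.1.1 v.1.1
      B.JK p v w - B.m * B.ϱ (γ 2) * (γ ⬝ᵥ B.s γ) * (B.Ω p ⬝ᵥ dlam) =
        B.qpVec p 0 * (γ ⬝ᵥ dlam) + B.qpVec p 1 * dlam 2) ∧
    -- horizontal gauge momenta `f(τ₁) j₁ + g(τ₁) j₂` correspond to solutions
    (∀ f g : ℝ → ℝ, B.SmoothOnQ f → B.SmoothOnQ g →
      (B.IsHorizontalGaugeMomentum (gaugeCombination f g) ↔ B.IsSolution f g)) ∧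
    -- there are two independent solutions, and they give two independent gauge momenta
    (∃ f₁ g₁ f₂ g₂ : ℝ → ℝ,
      (B.SmoothOnQ f₁ ∧ B.SmoothOnQ g₁ ∧ B.SmoothOnQ f₂ ∧ B.SmoothOnQ g₂) ∧
      B.IsSolution f₁ g₁ ∧ B.IsSolution f₂ g₂ ∧
      (∀ z ∈ Set.Icc (-1 : ℝ) 1, f₁ z * g₂ z - f₂ z * g₁ z ≠ 0) ∧
      B.IsHorizontalGaugeMomentum (gaugeCombination f₁ g₁) ∧
      B.IsHorizontalGaugeMomentum (gaugeCombination f₂ g₂) ∧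
      ∀ c₁ c₂ : ℝ,
        (∀ p ∈ B.phase, c₁ * gaugeCombination f₁ g₁ p + c₂ * gaugeCombination f₂ g₂ p = 0) →
        c₁ = 0 ∧ c₂ = 0) := by
  refine ⟨fun p hp => B.existsUnique_nonholonomicVector hp, fun p hp v hv w hw => ?_,
    fun f g hf hg => B.isHorizontalGaugeMomentum_gaugeCombination_iff hf hg, ?_⟩
  · obtain ⟨u, N, rfl⟩ := B.exists_of_mem_C hv
    obtain ⟨u', N', rfl⟩ := B.exists_of_mem_C hw
    have hg := B.isRot_of_mem hp
    have h : ∀ x y, mcForm p.1.1 (B.constrainedVec p x y).1.1 = x := fun x _ => hg.mcForm_cross x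
    simp only [h]
    exact B.JK_identity hp u N u' N'
  · obtain ⟨f₁, g₁, f₂, g₂, hs, h1, h2, hw⟩ := B.exists_fundamental_solutions
    exact ⟨f₁, g₁, f₂, g₂, hs, h1, h2, hw,
      B.isHorizontalGaugeMomentum_of_isSolution hs.1 hs.2.1 h1,
      B.isHorizontalGaugeMomentum_of_isSolution hs.2.2.1 hs.2.2.2 h2,
      B.gaugeCombination_independent (hw 0 (by norm_num))⟩
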